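/- Let $d\ge 1$ and let $\phi:\mathbb{R}^d\to\mathbb{R}$ be twice continuously differentiable, $\mu$-strongly convex and $L$-smooth, with $\widehat L$-Lipschitz Hessian in the spectral norm ($\mu,L,\widehat L>0$), and let $\mathbf{x}^*$ be its minimizer. Only values of a measurable $f$ with $|f(\mathbf{x})-\phi(\mathbf{x})|\le\sigma$ for all $\mathbf{x}$ can be queried ($\sigma\ge0$). Let $\alpha>0$, $0<\delta<1$, $0<\epsilon\le 1/2$, $k\ge1$ and $\ell\ge 1$. A random matrix $S\in\mathbb{R}^{d\times\ell}$ is an oblivious $(\gamma,k,\delta')$-sketching matrix if for every fixed $A\in\mathbb{R}^{d\times d}$, with probability at least $1-\delta'$, $\|A^\top SS^\top A-A^\top A\|_2\le\gamma\left(\|A\|_2^2+\|A\|_F^2/k\right)$. Let $S_0,\dots,S_{T-1}\in\mathbb{R}^{d\times\ell}$ be independent oblivious $(\tfrac14,k,\tfrac{\delta}{T})$-sketching matrices, and denote the $i$-th column of $S_t$ by $\mathbf{s}_t^{(i)}$. The algorithm iterates, from $\mathbf{x}_0\in\mathbb{R}^d$, $$\mathbf{x}_{t+1}=\mathbf{x}_t-\eta_t\sum_{i=1}^{\ell}\frac{f(\mathbf{x}_t+\alpha\mathbf{s}_t^{(i)})-f(\mathbf{x}_t-\alpha\mathbf{s}_t^{(i)})}{2\alpha}\,\mathbf{s}_t^{(i)},\qquad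 0\le t<T .$$ Put $C_1=\sup_{\mathbf{x}}\left(5\|\nabla^2\phi(\mathbf{x})\|_2+\mathrm{tr}(\nabla^2\phi(\mathbf{x}))/k\right)$, $C_2=\sqrt{\tfrac54+\tfrac{d}{4k}}$, $r=\frac{3\sqrt2\,C_1^2}{16\sqrt L\,\widehat L\,C_2^3}$, and let $C_3=\tfrac{5\ell}{4}+\tfrac{d\ell}{4k}$, or $C_3=d$ if $\|S_t\|_F^2=d$ almost surely for all $t$ (as for Rademacher and SRHT matrices). Let $$C_4=\mu^{-1}\left(\frac{20\ell\sigma^2}{\alpha^2}+\frac{5C_3^3\widehat L^2\alpha^4}{9}\right)+\frac{8C_2^3\widehat L}{3C_1^2\mu}\left(\frac{C_3^{9/2}\widehat L^3\alpha^6}{6^3}+\frac{\ell^{3/2}\sigma^3}{\alpha^3}\right).$$ The step size is $\eta_t=1/(2C_1)$ if $(\phi(\mathbf{x}_t)-\phi(\mathbf{x}^*))^{1/2}\le r$, and $\eta_t=(5+d/k)^{-1}L^{-1}$ otherwise. Let $\log^+u=\max(0,\log u)$ for $u>0$, $\log^+0=0$, and put $\Lambda_1=1+\log^+\!\big((\phi(\mathbf{x}_0)-\phi(\mathbf{x}^*))/r^2\big)$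 and $\Lambda_2=1+\log^+(\phi(\mathbf{x}_0)-\phi(\mathbf{x}^*))$. For every $c>0$ there are constants $K,K'>0$ depending only on $c$ such that, whenever $k>\log\frac T\delta$, $\ell\le c\,(k+\log\frac T\delta)$ and $\ell\le c\,d$, the following holds with $$N=K\left(\Lambda_1\,\frac d\ell\cdot\frac L\mu+\Lambda_2\,\frac{C_1}{\mu}\log\frac1\epsilon\right).$$ 1. If $T\ge N$, then $\phi(\mathbf{x}_T)-\phi(\mathbf{x}^*)\le\epsilon+C_4$ with probability at least $1-\delta$. In particular $T=\lceil N\rceil=\mathcal O\big(\frac d\ell\cdot\frac L\mu+\frac{C_1}\mu\log\frac1\epsilon\big)$ iterations are enough, the hidden constant depending only on $c,\Lambda_1,\Lambda_2$. 2. If $T=\lceil N\rceil$, then the number $Q$ of queries to $f$ made by the algorithm satisfies $$Q\le K'\left(\Lambda_1\,\frac{dL}{\mu}+\Lambda_2\,\mu^{-1}\sup_{\mathbf{x}}\Big(\ell\,\|\nabla^2\phi(\mathbf{x})\|_2+\mathrm{tr}(\nabla^2\phi(\mathbf{x}))\Big)\log\frac1\epsilon\right).$$ -/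

import Mathlib

open MeasureTheory ProbabilityTheory
open scoped Matrix

noncomputable section

/-- `ℝᵈ` with the Euclidean norm. -/
abbrev Eucl (d : ℕ) : Type := EuclideanSpace ℝ (Fin d)

/-! ### Zeroth-order oracle programs -/

/-- A computation whose only access to a function `f : X → ℝ` is through value queries.
`query x next` asks for `f x` and continues with `next (f x)`. -/
inductive OracleProgram (X R : Type) : Type
  | ret (r : R) : OracleProgram X R
  | query (x : X) (next : ℝ → OracleProgram X R) : OracleProgram X R

namespace OracleProgram

variable {X R R' : Type}

/-- The result of the program when the queries are answered by `f`. -/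
def run (f : X → ℝ) : OracleProgram X R → R
  | ret r => r
  | query x next => run f (next (f x))

/-- The number of queries made when the queries are answered by `f`. -/
def cost (f : X → ℝ) : OracleProgram X R → ℕ
  | ret _ => 0
  | query x next => cost f (next (f x)) + 1

/-- Run one program, then another one that depends on its result. -/
def bind : OracleProgram X R → (R → OracleProgram X R') → OracleProgram X R'
  | ret r, q => q r
  | query x next, q => query x (fun a => bind (next a) q)

theorem run_bind (f : X → ℝ) (p : OracleProgram X R) (q : R → OracleProgram X R') :
    (p.bind q).run f = (q (p.run f)).run f := by
  induction p with
  | ret r => rfl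
  | query x next ih => exact ih (f x)

theorem cost_bind (f : X → ℝ) (p : OracleProgram X R) (q : R → OracleProgram X R') :
    (p.bind q).cost f = p.cost f + (q (p.run f)).cost f := by
  induction p with
  | ret r => simp [bind, cost, run]
  | query x next ih =>
    have h := ih (f x)
    simp only [bind, cost, run] at h ⊢
    omega

end OracleProgram

/-- The `i`-th column of a matrix, as a vector of `ℝᵈ`. -/
def matCol {d l : ℕ} (S : Matrix (Fin d) (Fin l) ℝ) (i : Fin l) : Eucl d :=
  WithLp.toLp 2 (fun j => S j i)

/-- The central finite difference estimate
`∑ₛ (f (x + α s) - f (x - α s)) / (2 α) • s`, over a list of directions `s`. -/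
def gradEstimate {d : ℕ} (α : ℝ) (x : Eucl d) :
    List (Eucl d) → OracleProgram (Eucl d) (Eucl d)
  | [] => .ret 0
  | s :: ss =>
    .query (x + α • s) fun a =>
    .query (x - α • s) fun b =>
    (gradEstimate α x ss).bind fun g =>
    .ret (((a - b) / (2 * α)) • s + g)

/-- `T` iterations of the gradient-based zeroth-order algorithm started at `x₀`: at iteration `t`
the estimate `g` of the gradient at the current point `x` is formed along the columns of `S t`,
and `x` is replaced by `x - η x • g`. The output is the last iterate. -/
def zoAlgorithm {d l : ℕ} (α : ℝ) (η : Eucl d → ℝ) (S : ℕ → Matrix (Fin d) (Fin l) ℝ)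
    (x₀ : Eucl d) : ℕ → OracleProgram (Eucl d) (Eucl d)
  | 0 => .ret x₀
  | t + 1 =>
    (zoAlgorithm α η S x₀ t).bind fun x =>
    (gradEstimate α x (List.ofFn (matCol (S t)))).bind fun g =>
    .ret (x - η x • g)

theorem run_gradEstimate {d l : ℕ} (f : Eucl d → ℝ) (α : ℝ) (x : Eucl d)
    (s : Fin l → Eucl d) :
    (gradEstimate α x (List.ofFn s)).run f =
      ∑ i, ((f (x + α • s i) - f (x - α • s i)) / (2 * α)) • s i := by
  induction l with
  | zero => simp [gradEstimate, OracleProgram.run]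
  | succ l ih =>
    simp [List.ofFn_succ, gradEstimate, OracleProgram.run, OracleProgram.run_bind, ih,
      Fin.sum_univ_succ]

/-! ### Random sketching matrices -/

/-- The product (entrywise Borel) σ-algebra on matrices. -/
instance matrixMeasurableSpace {m n : Type*} : MeasurableSpace (Matrix m n ℝ) :=
  inferInstanceAs (MeasurableSpace (m → n → ℝ))

/-- The spectral norm of a square matrix. -/
def spectralNorm₂ {d : ℕ} (A : Matrix (Fin d) (Fin d) ℝ) : ℝ :=
  ‖Matrix.toEuclideanCLM (n := Fin d) (𝕜 := ℝ) A‖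

/-- The square of the Frobenius norm. -/
def frobeniusSq {d l : ℕ} (A : Matrix (Fin d) (Fin l) ℝ) : ℝ :=
  ∑ i, ∑ j, A i j ^ 2

/-- The random matrix `S` is an oblivious `(γ, k, δ)`-random sketching matrix for matrix product:
for every fixed matrix `A`, with probability at least `1 - δ`,
`‖Aᵀ S Sᵀ A - Aᵀ A‖₂ ≤ γ (‖A‖₂² + ‖A‖_F² / k)`. -/
def IsObliviousSketch {Ω : Type*} [MeasurableSpace Ω] (P : Measure Ω) {d l : ℕ}
    (γ k δ : ℝ) (S : Ω → Matrix (Fin d) (Fin l) ℝ) : Prop :=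
  ∀ A : Matrix (Fin d) (Fin d) ℝ,
    ENNReal.ofReal (1 - δ) ≤
      P {ω | spectralNorm₂ (Aᵀ * S ω * (S ω)ᵀ * A - Aᵀ * A) ≤
        γ * (spectralNorm₂ A ^ 2 + frobeniusSq A / k)}

/-! ### The objective function -/

/-- The Hessian of `φ` at `x`, as the derivative of the gradient. -/
def hessian {d : ℕ} (φ : Eucl d → ℝ) (x : Eucl d) : Eucl d →L[ℝ] Eucl d :=
  fderiv ℝ (gradient φ) x

/-- The trace of the Hessian. -/
def hessianTrace {d : ℕ} (φ : Eucl d → ℝ) (x : Eucl d) : ℝ :=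
  LinearMap.trace ℝ (Eucl d) (hessian φ x : Eucl d →ₗ[ℝ] Eucl d)

/-- `μ`-strong convexity of a differentiable function. -/
def IsStronglyConvex {d : ℕ} (φ : Eucl d → ℝ) (μ : ℝ) : Prop :=
  ∀ x y, φ x + inner ℝ (gradient φ x) (y - x) + μ / 2 * ‖y - x‖ ^ 2 ≤ φ y

/-- `L`-smoothness of a differentiable function. -/
def IsSmoothWith {d : ℕ} (φ : Eucl d → ℝ) (L : ℝ) : Prop :=
  ∀ x y, φ y ≤ φ x + inner ℝ (gradient φ x) (y - x) + L / 2 * ‖y - x‖ ^ 2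

/-- The Hessian is `Lh`-Lipschitz in the spectral norm. -/
def HasLipschitzHessian {d : ℕ} (φ : Eucl d → ℝ) (Lh : ℝ) : Prop :=
  ∀ x y, ‖hessian φ x - hessian φ y‖ ≤ Lh * ‖x - y‖

/-! ### The constants -/

/-- `C₁ = sup_x (5 ‖∇²φ(x)‖₂ + tr ∇²φ(x) / k)`. -/
def constC1 {d : ℕ} (φ : Eucl d → ℝ) (k : ℝ) : ℝ :=
  ⨆ x, (5 * ‖hessian φ x‖ + hessianTrace φ x / k)

/-- `C₂ = √(5/4 + d / (4 k))`. -/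
def constC2 (d : ℕ) (k : ℝ) : ℝ :=
  Real.sqrt (5 / 4 + d / (4 * k))

/-- `C₄ = μ⁻¹ (20 ℓ σ² / α² + 5 C₃³ Lh² α⁴ / 9)
  + (8 C₂³ Lh / (3 C₁² μ)) (C₃^(9/2) Lh³ α⁶ / 6³ + ℓ^(3/2) σ³ / α³)`, with `C₁`, `C₂`, `C₃` as arguments. -/
def constC4 (l : ℕ) (C₁ C₂ C₃ μ Lh σ α : ℝ) : ℝ :=
  μ⁻¹ * (20 * l * σ ^ 2 / α ^ 2 + 5 * C₃ ^ 3 * Lh ^ 2 * α ^ 4 / 9) +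
    8 * C₂ ^ 3 * Lh / (3 * C₁ ^ 2 * μ) *
      (C₃ ^ (9 / 2 : ℝ) * Lh ^ 3 * α ^ 6 / 6 ^ 3 + (l : ℝ) ^ (3 / 2 : ℝ) * σ ^ 3 / α ^ 3)

/-- The radius of the local region, which consists of the points `x` with
`(φ(x) - φ(x*))^(1/2) ≤ 3 √2 C₁² / (16 √L Lh C₂³)`. -/
def localRadius (C₁ C₂ L Lh : ℝ) : ℝ :=
  3 * Real.sqrt 2 * C₁ ^ 2 / (16 * Real.sqrt L * Lh * C₂ ^ 3)

open Classical in
/-- The step size at the point `x`: `1 / (2 C₁)` in the local region, and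
`(5 + d / k)⁻¹ L⁻¹` outside of it. Here `φmin` is the minimum of `φ`. -/
def stepSize {d : ℕ} (φ : Eucl d → ℝ) (φmin k L Lh : ℝ) (x : Eucl d) : ℝ :=
  if Real.sqrt (φ x - φmin) ≤ localRadius (constC1 φ k) (constC2 d k) L Lh then
    1 / (2 * constC1 φ k)
  else (5 + d / k)⁻¹ * L⁻¹

/-- The factor `1 + log⁺ ((φ(x₀) - φ(x*)) / r²)`, with `r` the radius of the local region. -/
def entryFactor {d : ℕ} (φ : Eucl d → ℝ) (φmin k L Lh : ℝ) (x₀ : Eucl d) : ℝ :=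
  1 + Real.posLog ((φ x₀ - φmin) / localRadius (constC1 φ k) (constC2 d k) L Lh ^ 2)

/-- The factor `1 + log⁺ (φ(x₀) - φ(x*))`. -/
def startFactor {d : ℕ} (φ : Eucl d → ℝ) (φmin : ℝ) (x₀ : Eucl d) : ℝ :=
  1 + Real.posLog (φ x₀ - φmin)

end

/-! Write `g` and `H` for the gradient and Hessian at the current point and `e` for the errors of
the finite differences. One step moves by `-η S u` with `u = Sᵀ g + e`. Since `f` is within `σ` of
`φ` and the even Taylor terms cancel in a central difference, `‖e‖²` is bounded by the noise terms
of `C₄`, provided that the sixth powers of the column norms sum to at most `C₃³`. The rest is a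
descent estimate needing three facts about `S`: `‖Sᵀ g‖²` is comparable to `‖g‖²`, `‖S‖²` is at most
`4 C₂²`, and `Sᵀ H S ≤ C₁`.

A union bound over three sketching events would exceed the failure budget `δ / T`, so all three
facts are drawn from one event. It is the sketching event of a symmetric square root `A` of `M`, a
weighted sum of `H`, the identity and `g gᵀ`. With the weights chosen so that `λ + tr M / k ≤ 1`,
where `λ` bounds the largest eigenvalue of `M`, the event for `A` controls `‖Sᵀ G z‖²` for every
positive semidefinite `G` with `h G ≤ M` (`exists_matrix_forall_sketch`,
`exists_matrix_isGoodSketch`). The price is a factor 4 in the bound on `‖S‖²`. It is absorbed in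
`C₃³` when `ℓ ≥ 8`; fewer columns force `d < 8`, where sketching the identity alone suffices.

Outside the local region, smoothness with step `1 / (4 C₂² L)` contracts the suboptimality towards
`C₄ / 2` (`global_step`). Inside, the cubic Taylor remainder is dominated by the linear term, so the
larger step `1 / (2 C₁)` contracts it towards `C₄` (`local_step`). `le_add_of_two_phase` combines
the two rates into a deterministic iteration count.

For the probability, the matrix `A` depends on the iterate, but the iterate is independent of the
next sketch. Fubini therefore reduces each failure to a fixed point, and a union bound over `T`
steps gives `δ` (`measure_exists_bad_le`). Taking `K ≥ exp 40` makes `k > log (T / δ) ≥ 40`, which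
the numerical constants need. -/

/-! ### Consequences of strong convexity, smoothness and a Lipschitz Hessian -/

section Calculus

variable {d : ℕ} {φ : Eucl d → ℝ}

theorem contDiff_gradient (h : ContDiff ℝ 2 φ) : ContDiff ℝ 1 (gradient φ) := by
  have h1 : ContDiff ℝ 1 (fderiv ℝ φ) := h.fderiv_right (by norm_num)
  exact (InnerProductSpace.toDual ℝ (Eucl d)).symm.toContinuousLinearEquiv.contDiff.comp h1

theorem hasFDerivAt_gradient (h : ContDiff ℝ 2 φ) (x : Eucl d) :
    HasFDerivAt (gradient φ) (hessian φ x) x :=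
  ((contDiff_gradient h).differentiable (by norm_num) x).hasFDerivAt

theorem continuous_gradient (h : ContDiff ℝ 2 φ) : Continuous (gradient φ) :=
  (contDiff_gradient h).continuous

theorem continuous_hessian (h : ContDiff ℝ 2 φ) : Continuous (hessian φ) :=
  (contDiff_gradient h).continuous_fderiv (by norm_num)

theorem fderiv_apply_eq_inner_gradient (x v : Eucl d) :
    fderiv ℝ φ x v = inner ℝ (gradient φ x) v := by
  rw [← toDual_gradient, InnerProductSpace.toDual_apply_apply]

theorem hasDerivAt_line (x v : Eucl d) (t : ℝ) : HasDerivAt (fun s : ℝ => x + s • v) v t := by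
  simpa using ((hasDerivAt_id t).smul_const v).const_add x

/-- Differentiating `⟨∇φ, v⟩ = Dφ v` along the line in direction `u` in two ways identifies the
derivative of the gradient with the second Fréchet derivative, whose symmetry can then be used. -/
theorem inner_hessian_eq (h : ContDiff ℝ 2 φ) (x u v : Eucl d) :
    inner ℝ (hessian φ x u) v = fderiv ℝ (fderiv ℝ φ) x u v := by
  have h1 : ContDiff ℝ 1 (fderiv ℝ φ) := h.fderiv_right (by norm_num)
  have h2 := (h1.differentiable (by norm_num) (x + (0 : ℝ) • u)).hasFDerivAt.comp_hasDerivAt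
    (0 : ℝ) (hasDerivAt_line x u 0)
  have h3 := (hasFDerivAt_gradient h (x + (0 : ℝ) • u)).comp_hasDerivAt (0 : ℝ)
    (hasDerivAt_line x u 0)
  have h4 := h2.clm_apply (hasDerivAt_const (0 : ℝ) v)
  have h5 := h3.inner ℝ (hasDerivAt_const (0 : ℝ) v)
  have h6 : (fun t : ℝ => (inner ℝ ((gradient φ ∘ fun s : ℝ => x + s • u) t) v : ℝ)) =
      fun t : ℝ => ((fderiv ℝ φ ∘ fun s : ℝ => x + s • u) t) v := by
    funext t
    exact (fderiv_apply_eq_inner_gradient _ _).symm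
  rw [h6] at h5
  simpa using h5.unique h4

theorem inner_hessian_symm (h : ContDiff ℝ 2 φ) (x u v : Eucl d) :
    inner ℝ (hessian φ x u) v = inner ℝ u (hessian φ x v) := by
  rw [real_inner_comm _ u, inner_hessian_eq h, inner_hessian_eq h]
  exact (h.contDiffAt.isSymmSndFDerivAt (by simp)).eq u v

theorem hasDerivAt_comp_line (h : ContDiff ℝ 2 φ) (x v : Eucl d) (t : ℝ) :
    HasDerivAt (fun s : ℝ => φ (x + s • v)) (inner ℝ (gradient φ (x + t • v)) v) t := by
  have h1 := (h.differentiable (by norm_num) (x + t • v)).hasFDerivAt.comp_hasDerivAt t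
    (hasDerivAt_line x v t)
  rwa [fderiv_apply_eq_inner_gradient] at h1

theorem hasDerivAt_inner_gradient_line (h : ContDiff ℝ 2 φ) (x v : Eucl d) (t : ℝ) :
    HasDerivAt (fun s : ℝ => (inner ℝ (gradient φ (x + s • v)) v : ℝ))
      (inner ℝ (hessian φ (x + t • v) v) v) t := by
  have h1 := (hasFDerivAt_gradient h (x + t • v)).comp_hasDerivAt t (hasDerivAt_line x v t)
  simpa using h1.inner ℝ (hasDerivAt_const t v)

theorem slope_le_of_hasDerivAt_of_forall_lt {p : ℝ → ℝ} {p' m : ℝ} (hd : HasDerivAt p p' 0)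
    (hm : ∀ s t, s < t → m * (t - s) ≤ p t - p s) : m ≤ p' := by
  have hd' : HasDerivAt (fun s => p s - m * s) (p' - m * 1) 0 :=
    hd.sub ((hasDerivAt_id (0 : ℝ)).const_mul m)
  have hmono : Monotone (fun s => p s - m * s) := by
    intro s t hst
    rcases hst.eq_or_lt with rfl | hlt
    · exact le_rfl
    have := hm s t hlt
    simp only
    linarith
  have := hmono.deriv_nonneg (x := 0)
  rw [hd'.deriv] at this
  linarith

theorem mul_norm_sq_le_inner_hessian (h : ContDiff ℝ 2 φ) {μ : ℝ} (hc : IsStronglyConvex φ μ)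
    (x v : Eucl d) : μ * ‖v‖ ^ 2 ≤ inner ℝ (hessian φ x v) v := by
  have hd := hasDerivAt_inner_gradient_line h x v 0
  rw [zero_smul, add_zero] at hd
  refine slope_le_of_hasDerivAt_of_forall_lt hd fun s t hlt => ?_
  have h1 := hc (x + s • v) (x + t • v)
  have h2 := hc (x + t • v) (x + s • v)
  have e1 : x + t • v - (x + s • v) = (t - s) • v := by module
  have e2 : x + s • v - (x + t • v) = (s - t) • v := by module
  rw [e1, inner_smul_right, norm_smul, mul_pow, Real.norm_eq_abs, sq_abs] at h1
  rw [e2, inner_smul_right, norm_smul, mul_pow, Real.norm_eq_abs, sq_abs] at h2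
  -- Adding the strong convexity inequalities in both orders cancels the values of `φ` and leaves
  -- strong monotonicity of the gradient along the line.
  have h3 : 0 ≤ (t - s) * (inner ℝ (gradient φ (x + t • v)) v -
      inner ℝ (gradient φ (x + s • v)) v - (t - s) * (μ * ‖v‖ ^ 2)) := by nlinarith
  have h4 := nonneg_of_mul_nonneg_right h3 (sub_pos.2 hlt)
  linarith

theorem inner_hessian_le_mul_norm_sq (h : ContDiff ℝ 2 φ) {L : ℝ} (hL : IsSmoothWith φ L)
    (x v : Eucl d) : inner ℝ (hessian φ x v) v ≤ L * ‖v‖ ^ 2 := by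
  have hd := (hasDerivAt_inner_gradient_line h x v 0).neg
  rw [zero_smul, add_zero] at hd
  rw [← neg_le_neg_iff]
  refine slope_le_of_hasDerivAt_of_forall_lt hd fun s t hlt => ?_
  have h1 := hL (x + s • v) (x + t • v)
  have h2 := hL (x + t • v) (x + s • v)
  have e1 : x + t • v - (x + s • v) = (t - s) • v := by module
  have e2 : x + s • v - (x + t • v) = (s - t) • v := by module
  rw [e1, inner_smul_right, norm_smul, mul_pow, Real.norm_eq_abs, sq_abs] at h1
  rw [e2, inner_smul_right, norm_smul, mul_pow, Real.norm_eq_abs, sq_abs] at h2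
  have h3 : 0 ≤ (t - s) * ((t - s) * (L * ‖v‖ ^ 2) - (inner ℝ (gradient φ (x + t • v)) v -
      inner ℝ (gradient φ (x + s • v)) v)) := by nlinarith
  have h4 := nonneg_of_mul_nonneg_right h3 (sub_pos.2 hlt)
  simp only [Pi.neg_apply]
  linarith

/-- The Cauchy–Schwarz inequality for a positive semidefinite symmetric operator. -/
theorem sq_inner_le_of_nonneg {E : Type*} [NormedAddCommGroup E] [InnerProductSpace ℝ E]
    {G : E →L[ℝ] E} (hs : ∀ u v, (inner ℝ (G u) v : ℝ) = inner ℝ u (G v))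
    (hp : ∀ v, 0 ≤ (inner ℝ (G v) v : ℝ)) (u v : E) :
    (inner ℝ (G u) v : ℝ) ^ 2 ≤ inner ℝ (G u) u * inner ℝ (G v) v := by
  have hq : ∀ t : ℝ, 0 ≤ inner ℝ (G v) v * (t * t) + (2 * inner ℝ (G u) v) * t +
      inner ℝ (G u) u := by
    intro t
    have := hp (u + t • v)
    have e : (inner ℝ (G v) u : ℝ) = inner ℝ (G u) v := by rw [hs, real_inner_comm]
    simp only [map_add, map_smul, inner_add_left, inner_add_right, inner_smul_left,
      inner_smul_right, e] at this
    simp at this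
    linarith
  have := discrim_le_zero hq
  unfold discrim at this
  nlinarith

/-- Cauchy–Schwarz for the form of `G`, applied to `v` and `G v`, followed by division by `‖G v‖²`.
This avoids diagonalizing `G`. -/
theorem norm_sq_le_of_inner_le {E : Type*} [NormedAddCommGroup E] [InnerProductSpace ℝ E]
    {G : E →L[ℝ] E} (hs : ∀ u v, (inner ℝ (G u) v : ℝ) = inner ℝ u (G v))
    (hp : ∀ v, 0 ≤ (inner ℝ (G v) v : ℝ)) {a : ℝ}
    (ha : ∀ v, inner ℝ (G v) v ≤ a * ‖v‖ ^ 2) (v : E) :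
    ‖G v‖ ^ 2 ≤ a * inner ℝ (G v) v := by
  have h1 := sq_inner_le_of_nonneg hs hp v (G v)
  rw [real_inner_self_eq_norm_sq] at h1
  have h2 := ha (G v)
  rcases eq_or_ne (G v) 0 with h0 | h0
  · simp [h0]
  have h3 : 0 < ‖G v‖ ^ 2 := by positivity
  have h4 : ‖G v‖ ^ 2 * ‖G v‖ ^ 2 ≤ (a * inner ℝ (G v) v) * ‖G v‖ ^ 2 := by
    nlinarith [mul_le_mul_of_nonneg_left h2 (hp v)]
  exact le_of_mul_le_mul_right h4 h3

theorem norm_hessian_le (h : ContDiff ℝ 2 φ) {μ L : ℝ} (hμ : 0 < μ) (hL0 : 0 < L)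
    (hc : IsStronglyConvex φ μ) (hL : IsSmoothWith φ L) (x : Eucl d) : ‖hessian φ x‖ ≤ L := by
  refine ContinuousLinearMap.opNorm_le_bound _ hL0.le fun v => ?_
  have hp : ∀ v, 0 ≤ (inner ℝ (hessian φ x v) v : ℝ) := fun v =>
    le_trans (by positivity) (mul_norm_sq_le_inner_hessian h hc x v)
  have h1 := norm_sq_le_of_inner_le (inner_hessian_symm h x) hp
    (inner_hessian_le_mul_norm_sq h hL x) v
  have h2 := inner_hessian_le_mul_norm_sq h hL x v
  refine le_of_sq_le_sq ?_ (by positivity)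
  nlinarith

theorem hessianTrace_eq_sum (x : Eucl d) : hessianTrace φ x =
    ∑ i, inner ℝ (EuclideanSpace.basisFun (Fin d) ℝ i)
      (hessian φ x (EuclideanSpace.basisFun (Fin d) ℝ i)) :=
  LinearMap.trace_eq_sum_inner _ (EuclideanSpace.basisFun (Fin d) ℝ)

theorem hessianTrace_nonneg (h : ContDiff ℝ 2 φ) {μ : ℝ} (hμ : 0 < μ)
    (hc : IsStronglyConvex φ μ) (x : Eucl d) : 0 ≤ hessianTrace φ x := by
  rw [hessianTrace_eq_sum]
  refine Finset.sum_nonneg fun i _ => ?_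
  rw [← inner_hessian_symm h]
  exact le_trans (by positivity) (mul_norm_sq_le_inner_hessian h hc x _)

theorem hessianTrace_le (h : ContDiff ℝ 2 φ) {L : ℝ} (hL : IsSmoothWith φ L) (x : Eucl d) :
    hessianTrace φ x ≤ d * L := by
  rw [hessianTrace_eq_sum]
  calc _ ≤ ∑ _i : Fin d, L := Finset.sum_le_sum fun i _ => by
        rw [← inner_hessian_symm h]
        refine (inner_hessian_le_mul_norm_sq h hL x _).trans ?_
        simp
    _ = d * L := by simp

theorem le_norm_hessian (h : ContDiff ℝ 2 φ) (hd : 0 < d) {μ : ℝ} (hc : IsStronglyConvex φ μ)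
    (x : Eucl d) : μ ≤ ‖hessian φ x‖ := by
  have h1 := mul_norm_sq_le_inner_hessian h hc x (EuclideanSpace.basisFun (Fin d) ℝ ⟨0, hd⟩)
  have h2 := (real_inner_le_norm (hessian φ x (EuclideanSpace.basisFun (Fin d) ℝ ⟨0, hd⟩))
    (EuclideanSpace.basisFun (Fin d) ℝ ⟨0, hd⟩))
  have h3 := (hessian φ x).le_opNorm (EuclideanSpace.basisFun (Fin d) ℝ ⟨0, hd⟩)
  simp only [OrthonormalBasis.norm_eq_one] at h1 h2 h3
  linarith

/-- The second order Taylor bound for a function on `ℝ` with Lipschitz second derivative. -/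
theorem abs_taylor_le {p p' p'' : ℝ → ℝ} {M : ℝ} (h1 : ∀ t, HasDerivAt p (p' t) t)
    (h2 : ∀ t, HasDerivAt p' (p'' t) t) (hM : ∀ t, 0 ≤ t → |p'' t - p'' 0| ≤ M * t) :
    |p 1 - p 0 - p' 0 - p'' 0 / 2| ≤ M / 6 := by
  have hq : ∀ t, 0 ≤ t → |p' t - p' 0 - p'' 0 * t| ≤ M / 2 * t ^ 2 := by
    intro t ht
    have hd : ∀ s, HasDerivAt (fun t => p' t - p' 0 - p'' 0 * t) (p'' s - p'' 0) s := fun s => by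
      simpa using ((h2 s).sub_const (p' 0)).fun_sub ((hasDerivAt_id s).const_mul (p'' 0))
    refine image_norm_le_of_norm_deriv_right_le_deriv_boundary (a := 0) (b := t)
      (f := fun t => p' t - p' 0 - p'' 0 * t) (B := fun t => M / 2 * t ^ 2)
      (B' := fun t => M * t) (fun s _ => (hd s).continuousAt.continuousWithinAt)
      (fun s _ => (hd s).hasDerivWithinAt) (by simp) (fun s => ?_)
      (fun s hs => hM s hs.1) (Set.right_mem_Icc.2 ht)
    have := (hasDerivAt_pow 2 s).const_mul (M / 2)
    refine this.congr_deriv ?_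
    norm_num
    ring
  have hd : ∀ s, HasDerivAt (fun t => p t - p 0 - p' 0 * t - p'' 0 / 2 * t ^ 2)
      (p' s - p' 0 - p'' 0 * s) s := fun s => by
    have := (((h1 s).sub_const (p 0)).fun_sub ((hasDerivAt_id s).const_mul (p' 0))).fun_sub
      ((hasDerivAt_pow 2 s).const_mul (p'' 0 / 2))
    refine this.congr_deriv ?_
    norm_num
    ring
  have := image_norm_le_of_norm_deriv_right_le_deriv_boundary (a := 0) (b := 1)
      (f := fun t => p t - p 0 - p' 0 * t - p'' 0 / 2 * t ^ 2) (B := fun t => M / 6 * t ^ 3)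
      (B' := fun t => M / 2 * t ^ 2) (fun s _ => (hd s).continuousAt.continuousWithinAt)
      (fun s _ => (hd s).hasDerivWithinAt) (by simp) (fun s => by
        have := (hasDerivAt_pow 3 s).const_mul (M / 6)
        refine this.congr_deriv ?_
        norm_num
        ring)
      (fun s hs => hq s hs.1) (Set.right_mem_Icc.2 zero_le_one)
  simpa using this

theorem abs_taylor_of_lipschitz_hessian (h : ContDiff ℝ 2 φ) {Lh : ℝ}
    (hH : HasLipschitzHessian φ Lh) (x v : Eucl d) :
    |φ (x + v) - φ x - inner ℝ (gradient φ x) v - inner ℝ (hessian φ x v) v / 2| ≤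
      Lh / 6 * ‖v‖ ^ 3 := by
  have := abs_taylor_le (M := Lh * ‖v‖ ^ 3) (hasDerivAt_comp_line h x v)
    (hasDerivAt_inner_gradient_line h x v) (fun t ht => by
      rw [← inner_sub_left, ← _root_.sub_apply]
      refine (abs_real_inner_le_norm _ _).trans ?_
      have h1 := (hessian φ (x + t • v) - hessian φ (x + (0 : ℝ) • v)).le_opNorm v
      have h2 := hH (x + t • v) (x + (0 : ℝ) • v)
      have e : x + t • v - (x + (0 : ℝ) • v) = t • v := by module
      rw [e, norm_smul, Real.norm_eq_abs, abs_of_nonneg ht] at h2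
      calc _ ≤ (Lh * (t * ‖v‖) * ‖v‖) * ‖v‖ := by
            gcongr
            exact h1.trans (by gcongr)
        _ = _ := by ring)
  simp only [zero_smul, add_zero, one_smul] at this
  convert this using 1
  ring

/-- The value and the Hessian term are even in the direction and cancel in the difference. Only the
cubic remainders survive, which gives second order accuracy in `α`. -/
theorem abs_central_difference_sub_le (h : ContDiff ℝ 2 φ) {Lh α : ℝ} (hα : 0 < α)
    (hH : HasLipschitzHessian φ Lh) (x v : Eucl d) :
    |(φ (x + α • v) - φ (x - α • v)) / (2 * α) - inner ℝ (gradient φ x) v| ≤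
      Lh * α ^ 2 / 6 * ‖v‖ ^ 3 := by
  have h1 := abs_taylor_of_lipschitz_hessian h hH x (α • v)
  have h2 := abs_taylor_of_lipschitz_hessian h hH x (-(α • v))
  rw [← sub_eq_add_neg] at h2
  simp only [map_neg, inner_neg_right, inner_neg_left, norm_neg, neg_neg] at h2
  rw [norm_smul, Real.norm_eq_abs, abs_of_pos hα] at h1 h2
  rw [inner_smul_right] at h1 h2
  have h3 := (abs_sub _ _).trans (add_le_add h1 h2)
  have e : (φ (x + α • v) - φ (x - α • v)) / (2 * α) - inner ℝ (gradient φ x) v =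
      (φ (x + α • v) - φ (x - α • v) - 2 * (α * inner ℝ (gradient φ x) v)) / (2 * α) := by
    field_simp
  rw [e, abs_div, abs_of_pos (by positivity : 0 < 2 * α), div_le_iff₀ (by positivity)]
  refine le_trans (le_of_eq ?_) (h3.trans (le_of_eq ?_))
  · congr 1; ring
  · ring

/-- The gradient is controlled by the suboptimality from above. -/
theorem norm_gradient_sq_le {L : ℝ} (hL0 : 0 < L) (hL : IsSmoothWith φ L) {xstar : Eucl d}
    (hmin : IsMinOn φ Set.univ xstar) (x : Eucl d) :
    ‖gradient φ x‖ ^ 2 ≤ 2 * L * (φ x - φ xstar) := by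
  -- The step `1 / L` minimizes the quadratic upper bound.
  have h1 := hL x (x - L⁻¹ • gradient φ x)
  have h2 := hmin (Set.mem_univ (x - L⁻¹ • gradient φ x))
  have e : x - L⁻¹ • gradient φ x - x = -(L⁻¹ • gradient φ x) := by abel
  rw [e, inner_neg_right, inner_smul_right, norm_neg, norm_smul, real_inner_self_eq_norm_sq,
    Real.norm_eq_abs, abs_of_pos (by positivity), mul_pow] at h1
  simp only [Set.mem_ofPred_eq] at h2
  have h3 : L⁻¹ * ‖gradient φ x‖ ^ 2 / 2 ≤ φ x - φ xstar := by
    have : L / 2 * (L⁻¹ ^ 2 * ‖gradient φ x‖ ^ 2) = L⁻¹ * ‖gradient φ x‖ ^ 2 / 2 := by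
      field_simp
    linarith
  have h4 := mul_le_mul_of_nonneg_left h3 (by positivity : 0 ≤ 2 * L)
  refine le_trans (le_of_eq ?_) h4
  field_simp

/-- The Polyak–Łojasiewicz inequality. -/
theorem le_norm_gradient_sq {μ : ℝ} (hμ : 0 < μ) (hc : IsStronglyConvex φ μ)
    (x xstar : Eucl d) : 2 * μ * (φ x - φ xstar) ≤ ‖gradient φ x‖ ^ 2 := by
  have h1 := hc x xstar
  have h2 := abs_le.1 (abs_real_inner_le_norm (gradient φ x) (xstar - x))
  nlinarith [sq_nonneg (‖gradient φ x‖ - μ * ‖xstar - x‖), h2.1]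

theorem strongConvexity_le_smoothness (h : ContDiff ℝ 2 φ) (hd : 0 < d) {μ L : ℝ} (hμ : 0 < μ)
    (hL0 : 0 < L) (hc : IsStronglyConvex φ μ) (hL : IsSmoothWith φ L) : μ ≤ L :=
  (le_norm_hessian h hd hc 0).trans (norm_hessian_le h hμ hL0 hc hL 0)

/-- A real supremum over an unbounded family takes the default value `0`, so boundedness must be
known before `C₁` and the supremum in the query bound dominate their members. -/
theorem bddAbove_norm_hessian_add_trace (h : ContDiff ℝ 2 φ) {μ L : ℝ} (hμ : 0 < μ)
    (hL0 : 0 < L) (hc : IsStronglyConvex φ μ) (hL : IsSmoothWith φ L) {a b : ℝ} (ha : 0 ≤ a)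
    (hb : 0 ≤ b) : BddAbove (Set.range fun x => a * ‖hessian φ x‖ + b * hessianTrace φ x) := by
  refine ⟨a * L + b * (d * L), ?_⟩
  rintro _ ⟨x, rfl⟩
  have h1 := norm_hessian_le h hμ hL0 hc hL x
  have h2 := hessianTrace_le h hL x
  simp only
  gcongr

theorem le_constC1 (h : ContDiff ℝ 2 φ) {μ L k : ℝ} (hμ : 0 < μ) (hL0 : 0 < L) (hk : 0 < k)
    (hc : IsStronglyConvex φ μ) (hL : IsSmoothWith φ L) (x : Eucl d) :
    5 * ‖hessian φ x‖ + hessianTrace φ x / k ≤ constC1 φ k := by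
  have := bddAbove_norm_hessian_add_trace h hμ hL0 hc hL (a := 5) (b := k⁻¹) (by norm_num)
    (by positivity)
  refine le_ciSup (f := fun x => 5 * ‖hessian φ x‖ + hessianTrace φ x / k) ?_ x
  simpa only [div_eq_inv_mul] using this

theorem five_mul_le_constC1 (h : ContDiff ℝ 2 φ) (hd : 0 < d) {μ L k : ℝ} (hμ : 0 < μ)
    (hL0 : 0 < L) (hk : 0 < k) (hc : IsStronglyConvex φ μ) (hL : IsSmoothWith φ L) :
    5 * μ ≤ constC1 φ k := by
  have h1 := le_constC1 h hμ hL0 hk hc hL 0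
  have h2 := le_norm_hessian h hd hc 0
  have h3 := hessianTrace_nonneg h hμ hc 0
  have h4 : 0 ≤ hessianTrace φ 0 / k := by positivity
  linarith

end Calculus

/-! ### Matrix square roots and Frobenius norms -/

theorem toEuclideanCLM_transpose {d : ℕ} (A : Matrix (Fin d) (Fin d) ℝ) :
    Matrix.toEuclideanCLM (n := Fin d) (𝕜 := ℝ) Aᵀ =
      ContinuousLinearMap.adjoint (Matrix.toEuclideanCLM (n := Fin d) (𝕜 := ℝ) A) := by
  rw [← Matrix.conjTranspose_eq_transpose_of_trivial, ← Matrix.star_eq_conjTranspose, map_star,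
    ContinuousLinearMap.star_eq_adjoint]

open scoped MatrixOrder Matrix.Norms.L2Operator in
/-- Every positive semidefinite operator on `ℝᵈ` is `A * Aᵀ` for a symmetric matrix `A`. -/
theorem exists_symm_matrix_sqrt {d : ℕ} {M : Eucl d →L[ℝ] Eucl d} (hM : M.IsPositive) :
    ∃ A : Matrix (Fin d) (Fin d) ℝ, Aᵀ = A ∧
      Matrix.toEuclideanCLM (n := Fin d) (𝕜 := ℝ) (A * A) = M := by
  set N := (Matrix.toEuclideanCLM (n := Fin d) (𝕜 := ℝ)).symm M with hN
  have hMN : Matrix.toEuclideanCLM (n := Fin d) (𝕜 := ℝ) N = M := StarAlgEquiv.apply_symm_apply _ _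
  have h1 : N.PosSemidef := by
    rw [← Matrix.isPositive_toEuclideanLin_iff, ← Matrix.coe_toEuclideanCLM_eq_toEuclideanLin, hMN]
    exact hM
  have h2 : 0 ≤ N := Matrix.nonneg_iff_posSemidef.2 h1
  refine ⟨CFC.sqrt N, ?_, ?_⟩
  · have := (IsSelfAdjoint.of_nonneg (CFC.sqrt_nonneg N)).star_eq
    rwa [Matrix.star_eq_conjTranspose, Matrix.conjTranspose_eq_transpose_of_trivial] at this
  · rw [CFC.sqrt_mul_sqrt_self N h2, hMN]

theorem frobeniusSq_eq_trace {d : ℕ} (A : Matrix (Fin d) (Fin d) ℝ) (hA : Aᵀ = A) :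
    frobeniusSq A = LinearMap.trace ℝ (Eucl d)
      (Matrix.toEuclideanCLM (n := Fin d) (𝕜 := ℝ) (A * A) : Eucl d →ₗ[ℝ] Eucl d) := by
  rw [LinearMap.trace_eq_sum_inner _ (EuclideanSpace.basisFun (Fin d) ℝ)]
  unfold frobeniusSq
  refine Finset.sum_congr rfl fun i _ => ?_
  have : (A * A) i i = ∑ j, A i j ^ 2 := by
    rw [Matrix.mul_apply]
    refine Finset.sum_congr rfl fun j _ => ?_
    rw [pow_two, ← congrFun (congrFun hA j) i, Matrix.transpose_apply]
  rw [ContinuousLinearMap.coe_coe, Matrix.inner_toEuclideanCLM, ← this]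
  simp

/-! ### One sketching event controlling gradient, Hessian and operator norm -/

section Sketch

variable {d l : ℕ}

/-- The squared norm of `Sᵀ v`. -/
noncomputable def sketchSq (S : Matrix (Fin d) (Fin l) ℝ) (v : Eucl d) : ℝ :=
  ∑ i, (inner ℝ (matCol S i) v : ℝ) ^ 2

/-- The vector `S u`. -/
noncomputable def colComb (S : Matrix (Fin d) (Fin l) ℝ) (u : Fin l → ℝ) : Eucl d :=
  ∑ i, u i • matCol S i

theorem sketchSq_eq_dotProduct (S : Matrix (Fin d) (Fin l) ℝ) (v : Eucl d) :
    sketchSq S v = (Sᵀ *ᵥ v.ofLp) ⬝ᵥ (Sᵀ *ᵥ v.ofLp) := by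
  unfold sketchSq dotProduct
  refine Finset.sum_congr rfl fun i _ => ?_
  have : (inner ℝ (matCol S i) v : ℝ) = (Sᵀ *ᵥ v.ofLp) i := by
    rw [EuclideanSpace.inner_eq_star_dotProduct]
    simp [matCol, Matrix.mulVec, dotProduct_comm, Matrix.transpose]
  rw [this, pow_two]

theorem inner_colComb (S : Matrix (Fin d) (Fin l) ℝ) (u : Fin l → ℝ) (v : Eucl d) :
    (inner ℝ (colComb S u) v : ℝ) = ∑ i, u i * inner ℝ (matCol S i) v := by
  simp [colComb, sum_inner, inner_smul_left]

theorem inner_colComb_sq_le (S : Matrix (Fin d) (Fin l) ℝ) (u : Fin l → ℝ) (v : Eucl d) :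
    (inner ℝ (colComb S u) v : ℝ) ^ 2 ≤ (∑ i, u i ^ 2) * sketchSq S v := by
  rw [inner_colComb]
  exact Finset.sum_mul_sq_le_sq_mul_sq _ _ _

/-- The sketching inequality for `A`, as a statement on quadratic forms. -/
theorem abs_sketchSq_sub_le {S : Matrix (Fin d) (Fin l) ℝ} {A : Matrix (Fin d) (Fin d) ℝ} {e : ℝ}
    (h : spectralNorm₂ (Aᵀ * S * Sᵀ * A - Aᵀ * A) ≤ e) (w : Eucl d) :
    |sketchSq S (Matrix.toEuclideanCLM (n := Fin d) (𝕜 := ℝ) A w) -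
      ‖Matrix.toEuclideanCLM (n := Fin d) (𝕜 := ℝ) A w‖ ^ 2| ≤ e * ‖w‖ ^ 2 := by
  have h1 : sketchSq S (Matrix.toEuclideanCLM (n := Fin d) (𝕜 := ℝ) A w) -
      ‖Matrix.toEuclideanCLM (n := Fin d) (𝕜 := ℝ) A w‖ ^ 2 =
      inner ℝ w (Matrix.toEuclideanCLM (n := Fin d) (𝕜 := ℝ) (Aᵀ * S * Sᵀ * A - Aᵀ * A) w) := by
    rw [Matrix.inner_toEuclideanCLM, sketchSq_eq_dotProduct, ← real_inner_self_eq_norm_sq,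
      EuclideanSpace.inner_eq_star_dotProduct, Matrix.ofLp_toEuclideanCLM, Matrix.sub_mulVec,
      dotProduct_sub]
    congr 1
    · simp only [← Matrix.mulVec_mulVec, Matrix.dotProduct_mulVec, Matrix.vecMul_transpose,
        Matrix.vecMul_mulVec]
      simp [Matrix.mul_assoc]
    · simp [← Matrix.mulVec_mulVec, Matrix.dotProduct_mulVec, ← Matrix.mulVec_transpose]
  rw [h1]
  calc _ ≤ ‖w‖ * ‖Matrix.toEuclideanCLM (n := Fin d) (𝕜 := ℝ) (Aᵀ * S * Sᵀ * A - Aᵀ * A) w‖ :=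
        abs_real_inner_le_norm _ _
    _ ≤ ‖w‖ * (e * ‖w‖) := by
        gcongr
        exact (ContinuousLinearMap.le_opNorm _ _).trans (by gcongr; exact h)
    _ = e * ‖w‖ ^ 2 := by ring

theorem inner_toEuclideanCLM_symm {A : Matrix (Fin d) (Fin d) ℝ} (hA : Aᵀ = A) (u v : Eucl d) :
    (inner ℝ (Matrix.toEuclideanCLM (n := Fin d) (𝕜 := ℝ) A u) v : ℝ) =
      inner ℝ u (Matrix.toEuclideanCLM (n := Fin d) (𝕜 := ℝ) A v) := by
  conv_rhs => rw [← ContinuousLinearMap.adjoint_inner_left, ← toEuclideanCLM_transpose, hA]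

/-- If a positive definite operator `M` has norm plus `trace / k` at most `1`, one sketching event
controls `Sᵀ G z` for all `z` and all positive semidefinite `G` with `h • G ≤ M`. -/
theorem exists_matrix_forall_sketch {M : Eucl d →L[ℝ] Eucl d} {k m lam : ℝ}
    (hm : 0 < m)
    (hsymm : ∀ u v, (inner ℝ (M u) v : ℝ) = inner ℝ u (M v))
    (hlow : ∀ v, m * ‖v‖ ^ 2 ≤ inner ℝ (M v) v)
    (hup : ∀ v, inner ℝ (M v) v ≤ lam * ‖v‖ ^ 2) (hlam : 0 ≤ lam)
    (htr : lam + LinearMap.trace ℝ (Eucl d) (M : Eucl d →ₗ[ℝ] Eucl d) / k ≤ 1) :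
    ∃ A : Matrix (Fin d) (Fin d) ℝ, ∀ S : Matrix (Fin d) (Fin l) ℝ,
      spectralNorm₂ (Aᵀ * S * Sᵀ * A - Aᵀ * A) ≤
        1 / 4 * (spectralNorm₂ A ^ 2 + frobeniusSq A / k) →
      ∀ (G : Eucl d →L[ℝ] Eucl d) (h : ℝ), 0 < h →
        (∀ u v, (inner ℝ (G u) v : ℝ) = inner ℝ u (G v)) →
        (∀ v, 0 ≤ (inner ℝ (G v) v : ℝ)) →
        (∀ v, h * inner ℝ (G v) v ≤ inner ℝ (M v) v) →
        ∀ z, |sketchSq S (G z) - ‖G z‖ ^ 2| ≤ 1 / 4 * (inner ℝ (G z) z / h) := by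
  have hpos : M.IsPositive := by
    rw [ContinuousLinearMap.isPositive_iff]
    refine ⟨fun u v => hsymm u v, fun v => le_trans (by positivity) (hlow v)⟩
  obtain ⟨A, hA, hAM⟩ := exists_symm_matrix_sqrt hpos
  set a := Matrix.toEuclideanCLM (n := Fin d) (𝕜 := ℝ) A with ha
  have haa : ∀ v, a (a v) = M v := fun v => by
    rw [← hAM, map_mul]; rfl
  have hasymm : ∀ u v, (inner ℝ (a u) v : ℝ) = inner ℝ u (a v) := inner_toEuclideanCLM_symm hA
  have hnorm : ∀ v, ‖a v‖ ^ 2 = inner ℝ (M v) v := fun v => by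
    rw [← real_inner_self_eq_norm_sq, hasymm, haa, real_inner_comm]
  have hfro := frobeniusSq_eq_trace A hA
  rw [hAM] at hfro
  have hspec : spectralNorm₂ A ^ 2 ≤ lam := by
    have : spectralNorm₂ A ≤ √lam := by
      refine ContinuousLinearMap.opNorm_le_bound _ (Real.sqrt_nonneg _) fun v => ?_
      refine le_of_sq_le_sq ?_ (by positivity)
      rw [mul_pow, Real.sq_sqrt hlam]
      exact (hnorm v).trans_le (hup v)
    calc spectralNorm₂ A ^ 2 ≤ √lam ^ 2 := pow_le_pow_left₀ (norm_nonneg _) this 2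
      _ = lam := Real.sq_sqrt hlam
  have hsurj : Function.Surjective M := by
    have hinj : Function.Injective (M : Eucl d →ₗ[ℝ] Eucl d) := by
      rw [injective_iff_map_eq_zero]
      intro v hv
      have := hlow v
      rw [ContinuousLinearMap.coe_coe] at hv
      rw [hv, inner_zero_left] at this
      have h2 : ‖v‖ ^ 2 ≤ 0 := by nlinarith
      simpa using le_antisymm h2 (sq_nonneg _)
    exact LinearMap.injective_iff_surjective.1 hinj
  refine ⟨A, fun S hS G h hh hGs hGp hGM z => ?_⟩
  -- With `M w' = G z` the sketched vector is `G z = A (A w')`, so the event applied to `A w'` has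
  -- error at most a quarter of `‖A w'‖² = ⟨G z, w'⟩`.
  obtain ⟨w', hw'⟩ := hsurj (G z)
  have h1 := abs_sketchSq_sub_le hS (a w')
  rw [← ha, haa, hw'] at h1
  refine h1.trans ?_
  have h2 : ‖a w'‖ ^ 2 ≤ inner ℝ (G z) z / h := by
    rw [hnorm, hw', le_div_iff₀ hh]
    -- Cauchy–Schwarz and `h G ≤ M` give `h ⟨G z, w'⟩² ≤ ⟨G z, z⟩ ⟨G z, w'⟩`; one factor `⟨G z, w'⟩`
    -- is then divided out.
    have h3 := sq_inner_le_of_nonneg hGs hGp z w'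
    have h4 := hGM w'
    rw [hw'] at h4
    have h5 := hGp w'
    have h6 := hGp z
    rcases eq_or_lt_of_le (h5.trans (le_of_eq rfl)) with h7 | h7
    · have : (inner ℝ (G z) w' : ℝ) ^ 2 ≤ 0 := by rw [← h7, mul_zero] at h3; exact h3
      have : (inner ℝ (G z) w' : ℝ) = 0 := by nlinarith
      rw [this, zero_mul]; exact h6
    · have h8 : 0 < (inner ℝ (G z) w' : ℝ) := by nlinarith
      have h9 : (inner ℝ (G z) w' * h) * inner ℝ (G z) w' ≤ inner ℝ (G z) z * inner ℝ (G z) w' := by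
        nlinarith
      exact le_of_mul_le_mul_right h9 h8
  have h3 : 1 / 4 * (spectralNorm₂ A ^ 2 + frobeniusSq A / k) ≤ 1 / 4 := by
    have : frobeniusSq A / k = LinearMap.trace ℝ (Eucl d) (M : Eucl d →ₗ[ℝ] Eucl d) / k := by
      rw [hfro]
    linarith
  calc _ ≤ 1 / 4 * ‖a w'‖ ^ 2 := by gcongr
    _ ≤ _ := by gcongr

/-- The properties of a sketching matrix that make one step of the algorithm succeed at a point
with gradient `g` and Hessian `H`. -/
structure IsGoodSketch (S : Matrix (Fin d) (Fin l) ℝ) (Q : ℝ) (g : Eucl d)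
    (H : Eucl d →L[ℝ] Eucl d) (C₁ : ℝ) : Prop where
  upper : ∀ v, sketchSq S v ≤ Q * ‖v‖ ^ 2
  grad_lower : 485 / 1000 * ‖g‖ ^ 2 ≤ sketchSq S g
  grad_upper : sketchSq S g ≤ 15125 / 10000 * ‖g‖ ^ 2
  hess : ∀ u, inner ℝ (H (colComb S u)) (colComb S u) ≤ C₁ * ∑ i, u i ^ 2

/-- A duality argument: for `z = S u`, Cauchy–Schwarz gives `⟨G z, z⟩² = ⟨u, Sᵀ G z⟩² ≤ ‖u‖² b ⟨G z,
z⟩`, and one factor `⟨G z, z⟩` cancels. A bound on `Sᵀ G` thus becomes the bound `Sᵀ G S ≤ b`. -/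
theorem inner_colComb_le_of_sketchSq_le {S : Matrix (Fin d) (Fin l) ℝ}
    {G : Eucl d →L[ℝ] Eucl d} (hGp : ∀ v, 0 ≤ (inner ℝ (G v) v : ℝ)) {b : ℝ}
    (hb : 0 ≤ b) (h : ∀ z, sketchSq S (G z) ≤ b * inner ℝ (G z) z) (u : Fin l → ℝ) :
    inner ℝ (G (colComb S u)) (colComb S u) ≤ b * ∑ i, u i ^ 2 := by
  have h1 := inner_colComb_sq_le S u (G (colComb S u))
  rw [real_inner_comm] at h1
  have h2 := h (colComb S u)
  have h3 : 0 ≤ ∑ i, u i ^ 2 := Finset.sum_nonneg fun i _ => sq_nonneg _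
  have h4 : 0 ≤ sketchSq S (G (colComb S u)) := Finset.sum_nonneg fun i _ => sq_nonneg _
  have h6 := hGp (colComb S u)
  rcases eq_or_lt_of_le h6 with h5 | h5
  · rw [← h5]
    positivity
  · have h7 : inner ℝ (G (colComb S u)) (colComb S u) * inner ℝ (G (colComb S u)) (colComb S u) ≤
        (b * ∑ i, u i ^ 2) * inner ℝ (G (colComb S u)) (colComb S u) := by
      nlinarith [mul_le_mul_of_nonneg_left h2 h3]
    exact le_of_mul_le_mul_right h7 h5

/-- The combined sketching operator `M` for a gradient `g` and a Hessian `H`. -/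
noncomputable def sketchTarget (k : ℝ) (g : Eucl d) (H : Eucl d →L[ℝ] Eucl d) :
    Eucl d →L[ℝ] Eucl d :=
  (4 * (‖H‖ + LinearMap.trace ℝ (Eucl d) (H : Eucl d →ₗ[ℝ] Eucl d) / k))⁻¹ • H +
    (4 * (1 + d / k))⁻¹ • ContinuousLinearMap.id ℝ (Eucl d) +
    (2 * (‖g‖ ^ 2 * (1 + 1 / k)))⁻¹ • InnerProductSpace.rankOne ℝ g g

theorem inner_sketchTarget (k : ℝ) (g : Eucl d) (H : Eucl d →L[ℝ] Eucl d) (u v : Eucl d) :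
    (inner ℝ (sketchTarget k g H u) v : ℝ) =
      (4 * (‖H‖ + LinearMap.trace ℝ (Eucl d) (H : Eucl d →ₗ[ℝ] Eucl d) / k))⁻¹ * inner ℝ (H u) v +
      (4 * (1 + d / k))⁻¹ * inner ℝ u v +
      (2 * (‖g‖ ^ 2 * (1 + 1 / k)))⁻¹ * (inner ℝ g u * inner ℝ g v) := by
  simp [sketchTarget, inner_add_left, inner_smul_left]

theorem trace_sketchTarget (k : ℝ) (g : Eucl d) (H : Eucl d →L[ℝ] Eucl d) :
    LinearMap.trace ℝ (Eucl d) (sketchTarget k g H : Eucl d →ₗ[ℝ] Eucl d) =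
      (4 * (‖H‖ + LinearMap.trace ℝ (Eucl d) (H : Eucl d →ₗ[ℝ] Eucl d) / k))⁻¹ *
        LinearMap.trace ℝ (Eucl d) (H : Eucl d →ₗ[ℝ] Eucl d) +
      (4 * (1 + d / k))⁻¹ * d +
      (2 * (‖g‖ ^ 2 * (1 + 1 / k)))⁻¹ * ‖g‖ ^ 2 := by
  have h1 : LinearMap.trace ℝ (Eucl d) (ContinuousLinearMap.id ℝ (Eucl d) : Eucl d →ₗ[ℝ] Eucl d) =
      d := by
    rw [ContinuousLinearMap.coe_id, LinearMap.trace_id]; simp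
  have h2 : LinearMap.trace ℝ (Eucl d)
      (InnerProductSpace.rankOne ℝ g g : Eucl d →ₗ[ℝ] Eucl d) = ‖g‖ ^ 2 := by
    rw [InnerProductSpace.trace_rankOne, real_inner_self_eq_norm_sq]
  simp only [sketchTarget, ContinuousLinearMap.toLinearMap_add, ContinuousLinearMap.toLinearMap_smul,
    map_add, map_smul, smul_eq_mul, h1, h2]

/-- One sketching event for a suitable matrix makes the sketch good. -/
theorem exists_matrix_isGoodSketch (hd : 0 < d) {k μ C₁ : ℝ} (hk : 40 ≤ k) (hμ : 0 < μ)
    {g : Eucl d} {H : Eucl d →L[ℝ] Eucl d}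
    (hs : ∀ u v, (inner ℝ (H u) v : ℝ) = inner ℝ u (H v))
    (hlow : ∀ v, μ * ‖v‖ ^ 2 ≤ inner ℝ (H v) v)
    (hC : 5 * ‖H‖ + LinearMap.trace ℝ (Eucl d) (H : Eucl d →ₗ[ℝ] Eucl d) / k ≤ C₁) :
    ∃ A : Matrix (Fin d) (Fin d) ℝ, ∀ S : Matrix (Fin d) (Fin l) ℝ,
      spectralNorm₂ (Aᵀ * S * Sᵀ * A - Aᵀ * A) ≤
        1 / 4 * (spectralNorm₂ A ^ 2 + frobeniusSq A / k) →
      IsGoodSketch S (4 * (5 / 4 + d / (4 * k))) g H C₁ := by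
  have hk0 : 0 < k := by linarith
  have hpos : ∀ v, 0 ≤ (inner ℝ (H v) v : ℝ) := fun v => le_trans (by positivity) (hlow v)
  set τ := LinearMap.trace ℝ (Eucl d) (H : Eucl d →ₗ[ℝ] Eucl d) with hτ
  have hτ0 : 0 ≤ τ := by
    rw [hτ, LinearMap.trace_eq_sum_inner _ (EuclideanSpace.basisFun (Fin d) ℝ)]
    exact Finset.sum_nonneg fun i _ => by
      rw [real_inner_comm]; exact hpos _
  have hnormle : ∀ v, inner ℝ (H v) v ≤ ‖H‖ * ‖v‖ ^ 2 := fun v =>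
    (real_inner_le_norm _ _).trans (by
      rw [pow_two, ← mul_assoc]; gcongr; exact H.le_opNorm v)
  have hHpos : 0 < ‖H‖ := by
    have h1 := hlow (EuclideanSpace.basisFun (Fin d) ℝ ⟨0, hd⟩)
    have h2 := hnormle (EuclideanSpace.basisFun (Fin d) ℝ ⟨0, hd⟩)
    simp only [OrthonormalBasis.norm_eq_one] at h1 h2
    linarith
  set E := ‖H‖ + τ / k with hE
  have hτk : 0 ≤ τ / k := by positivity
  have hE0 : 0 < E := by positivity
  set D := 1 + (d : ℝ) / k with hD
  have hD0 : 0 < D := by positivity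
  have hM := inner_sketchTarget k g H
  have hT := trace_sketchTarget k g H
  simp only [← hτ, ← hE, ← hD] at hM hT
  -- For `g = 0` this weight is `0⁻¹ = 0` and the rank-one term disappears.
  set c := (2 * (‖g‖ ^ 2 * (1 + 1 / k)))⁻¹ with hc
  have hc0 : 0 ≤ c := by positivity
  have hcg : c * ‖g‖ ^ 2 * (1 + 1 / k) ≤ 1 / 2 := by
    rcases eq_or_ne g 0 with h0 | h0
    · simp [h0]
    · have : 0 < ‖g‖ := norm_pos_iff.2 h0
      rw [hc]
      field_simp
      norm_num
  -- The shares of norm plus `trace / k` are 1/4 for `H`, 1/4 for the identity and at most 1/2 for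
  -- `g gᵀ`. The identity term also makes `M` invertible.
  obtain ⟨A, hA⟩ := exists_matrix_forall_sketch (l := l) (M := sketchTarget k g H) (k := k)
    (m := (4 * D)⁻¹) (lam := (4 * E)⁻¹ * ‖H‖ + (4 * D)⁻¹ + c * ‖g‖ ^ 2) (by positivity)
    (fun u v => by
      have e1 : (inner ℝ u (sketchTarget k g H v) : ℝ) = inner ℝ (sketchTarget k g H v) u :=
        real_inner_comm _ _
      have e2 : (inner ℝ (H u) v : ℝ) = inner ℝ (H v) u := by rw [hs, real_inner_comm]
      have e3 : (inner ℝ u v : ℝ) = inner ℝ v u := real_inner_comm _ _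
      rw [e1, hM, hM, e2, e3]
      ring)
    (fun v => by
      rw [hM, real_inner_self_eq_norm_sq]
      have := hpos v
      have h1 : 0 ≤ c * (inner ℝ g v * inner ℝ g v) := mul_nonneg hc0 (mul_self_nonneg _)
      have h2 : 0 ≤ (4 * E)⁻¹ * inner ℝ (H v) v := by positivity
      linarith)
    (fun v => by
      rw [hM, real_inner_self_eq_norm_sq, add_mul, add_mul]
      have h1 : (inner ℝ g v * inner ℝ g v : ℝ) ≤ ‖g‖ ^ 2 * ‖v‖ ^ 2 := by
        rw [← mul_pow, ← pow_two]
        exact sq_le_sq' (by linarith [(abs_le.1 (abs_real_inner_le_norm g v)).1])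
          (real_inner_le_norm _ _)
      have h2 := mul_le_mul_of_nonneg_left h1 hc0
      have h3 := mul_le_mul_of_nonneg_left (hnormle v) (by positivity : 0 ≤ (4 * E)⁻¹)
      linarith)
    (by positivity)
    (by
      rw [hT]
      have h1 : (4 * E)⁻¹ * ‖H‖ + (4 * E)⁻¹ * τ / k = 1 / 4 := by
        rw [mul_div_assoc, ← mul_add, ← hE]; field_simp
      have h2 : (4 * D)⁻¹ + (4 * D)⁻¹ * d / k = 1 / 4 := by
        rw [mul_div_assoc, ← mul_one_add, ← hD]; field_simp
      have h3 : c * ‖g‖ ^ 2 + c * ‖g‖ ^ 2 / k ≤ 1 / 2 := by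
        refine le_trans (le_of_eq ?_) hcg
        ring
      rw [add_div, add_div]
      linarith)
  refine ⟨A, fun S hS => ?_⟩
  have key := hA S hS
  have hid := key (ContinuousLinearMap.id ℝ (Eucl d)) (4 * D)⁻¹ (by positivity) (fun _ _ => rfl)
    (fun v => by simp) (fun v => by
      rw [hM]
      have := hpos v
      have h1 : 0 ≤ c * (inner ℝ g v * inner ℝ g v) := mul_nonneg hc0 (mul_self_nonneg _)
      have h2 : 0 ≤ (4 * E)⁻¹ * inner ℝ (H v) v := by positivity
      simp only [ContinuousLinearMap.id_apply]
      linarith)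
  have hH := key H (4 * E)⁻¹ (by positivity) hs hpos (fun v => by
      rw [hM, real_inner_self_eq_norm_sq]
      have h1 : 0 ≤ c * (inner ℝ g v * inner ℝ g v) := mul_nonneg hc0 (mul_self_nonneg _)
      have h2 : 0 ≤ (4 * D)⁻¹ * ‖v‖ ^ 2 := by positivity
      linarith)
  have hg : |sketchSq S g - ‖g‖ ^ 2| ≤ 5125 / 10000 * ‖g‖ ^ 2 := by
    rcases eq_or_ne g 0 with h0 | h0
    · simp [h0, sketchSq]
    have hgn : 0 < ‖g‖ := norm_pos_iff.2 h0
    -- With `G = g gᵀ` and `z = g / ‖g‖²` one has `G z = g` and `⟨G z, z⟩ = 1`, so the error is at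
    -- most `1 / (4 c) = ‖g‖² (1 + 1 / k) / 2`. For `k ≥ 40` this is at most `0.5125 ‖g‖²`.
    have h1 := key (InnerProductSpace.rankOne ℝ g g) c (by positivity)
      (fun u v => by simp [inner_smul_left, inner_smul_right, real_inner_comm, mul_comm])
      (fun v => by
        simp only [InnerProductSpace.rankOne_apply, inner_smul_left]
        exact mul_self_nonneg _)
      (fun v => by
        rw [hM, real_inner_self_eq_norm_sq]
        have := hpos v
        have h2 : 0 ≤ (4 * D)⁻¹ * ‖v‖ ^ 2 := by positivity
        have h3 : 0 ≤ (4 * E)⁻¹ * inner ℝ (H v) v := by positivity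
        simp only [InnerProductSpace.rankOne_apply, inner_smul_left]
        simp only [conj_trivial]
        linarith)
      ((‖g‖ ^ 2)⁻¹ • g)
    have e : InnerProductSpace.rankOne ℝ g g ((‖g‖ ^ 2)⁻¹ • g) = g := by
      rw [InnerProductSpace.rankOne_apply, inner_smul_right, real_inner_self_eq_norm_sq,
        inv_mul_cancel₀ (by positivity), one_smul]
    rw [e, inner_smul_right, real_inner_self_eq_norm_sq, inv_mul_cancel₀ (by positivity)] at h1
    refine h1.trans ?_
    rw [hc, div_inv_eq_mul]
    have h4 : 1 / k ≤ 1 / 40 := one_div_le_one_div_of_le (by norm_num) hk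
    nlinarith [sq_nonneg ‖g‖]
  rw [abs_le] at hg
  refine ⟨fun v => ?_, by linarith [hg.1], by linarith [hg.2], ?_⟩
  · have h1 := (abs_le.1 (hid v)).2
    simp only [ContinuousLinearMap.id_apply, real_inner_self_eq_norm_sq, div_inv_eq_mul] at h1
    have h2 : (1 : ℝ) + D ≤ 4 * (5 / 4 + d / (4 * k)) := by
      have : (d : ℝ) / (4 * k) = d / k / 4 := by field_simp
      rw [hD, this]; linarith
    calc sketchSq S v ≤ (1 + D) * ‖v‖ ^ 2 := by linarith
      _ ≤ _ := by gcongr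
  · refine inner_colComb_le_of_sketchSq_le hpos (by linarith) fun z => ?_
    have h1 := (abs_le.1 (hH z)).2
    rw [div_inv_eq_mul] at h1
    -- Here `‖Sᵀ H z‖² ≤ ‖H z‖² + E ⟨H z, z⟩ ≤ (‖H‖ + E) ⟨H z, z⟩`, and `‖H‖ + E = 2 ‖H‖ + tr H / k
    -- ≤ C₁`.
    have h2 := norm_sq_le_of_inner_le hs hpos hnormle z
    have h3 : (‖H‖ + E) * inner ℝ (H z) z ≤ C₁ * inner ℝ (H z) z :=
      mul_le_mul_of_nonneg_right (by linarith) (hpos z)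
    linarith

/-- In small dimension the sketching event for a multiple of the identity suffices. -/
theorem exists_matrix_isGoodSketch_of_small (hd : 0 < d) (hd8 : d < 8) {k μ C₁ : ℝ} (hk : 40 ≤ k)
    (hμ : 0 < μ) {g : Eucl d} {H : Eucl d →L[ℝ] Eucl d}
    (hs : ∀ u v, (inner ℝ (H u) v : ℝ) = inner ℝ u (H v))
    (hlow : ∀ v, μ * ‖v‖ ^ 2 ≤ inner ℝ (H v) v)
    (hC : 5 * ‖H‖ + LinearMap.trace ℝ (Eucl d) (H : Eucl d →ₗ[ℝ] Eucl d) / k ≤ C₁) :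
    ∃ A : Matrix (Fin d) (Fin d) ℝ, ∀ S : Matrix (Fin d) (Fin l) ℝ,
      spectralNorm₂ (Aᵀ * S * Sᵀ * A - Aᵀ * A) ≤
        1 / 4 * (spectralNorm₂ A ^ 2 + frobeniusSq A / k) →
      IsGoodSketch S (5 / 4 + d / (4 * k)) g H C₁ := by
  have hk0 : 0 < k := by linarith
  have hpos : ∀ v, 0 ≤ (inner ℝ (H v) v : ℝ) := fun v => le_trans (by positivity) (hlow v)
  set τ := LinearMap.trace ℝ (Eucl d) (H : Eucl d →ₗ[ℝ] Eucl d) with hτ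
  have hτ0 : 0 ≤ τ := by
    rw [hτ, LinearMap.trace_eq_sum_inner _ (EuclideanSpace.basisFun (Fin d) ℝ)]
    exact Finset.sum_nonneg fun i _ => by
      rw [real_inner_comm]; exact hpos _
  have hnormle : ∀ v, inner ℝ (H v) v ≤ ‖H‖ * ‖v‖ ^ 2 := fun v =>
    (real_inner_le_norm _ _).trans (by
      rw [pow_two, ← mul_assoc]; gcongr; exact H.le_opNorm v)
  have hτk : 0 ≤ τ / k := by positivity
  have hdk : (d : ℝ) / k ≤ 1 / 5 := by
    rw [div_le_iff₀ hk0]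
    have : (d : ℝ) ≤ 8 := by exact_mod_cast hd8.le
    linarith
  have hdk0 : 0 ≤ (d : ℝ) / k := by positivity
  have hd4 : (d : ℝ) / (4 * k) = d / k / 4 := by field_simp
  set D := 1 + (d : ℝ) / k with hD
  have hD0 : 0 < D := by positivity
  obtain ⟨A, hA⟩ := exists_matrix_forall_sketch (l := l)
    (M := D⁻¹ • ContinuousLinearMap.id ℝ (Eucl d)) (k := k) (m := D⁻¹) (lam := D⁻¹)
    (by positivity) (fun u v => by simp [inner_smul_left, inner_smul_right])
    (fun v => by simp [inner_smul_left])
    (fun v => by simp [inner_smul_left]) (by positivity)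
    (by
      rw [ContinuousLinearMap.toLinearMap_smul, ContinuousLinearMap.coe_id, map_smul,
        LinearMap.trace_id]
      simp only [finrank_euclideanSpace, Fintype.card_fin, smul_eq_mul]
      rw [mul_div_assoc, ← mul_one_add, ← hD, inv_mul_cancel₀ hD0.ne'])
  refine ⟨A, fun S hS => ?_⟩
  have key : ∀ v, |sketchSq S v - ‖v‖ ^ 2| ≤ 1 / 4 * (‖v‖ ^ 2 * D) := fun v => by
    have := hA S hS (ContinuousLinearMap.id ℝ (Eucl d)) D⁻¹ (by positivity) (fun _ _ => rfl)
      (fun v => by simp) (fun v => by simp [inner_smul_left]) v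
    simpa using this
  have hup : ∀ v, sketchSq S v ≤ (5 / 4 + d / (4 * k)) * ‖v‖ ^ 2 := fun v => by
    have h1 := (abs_le.1 (key v)).2
    rw [hd4]
    nlinarith
  refine ⟨hup, ?_, ?_, ?_⟩
  · have h1 := (abs_le.1 (key g)).1
    nlinarith [sq_nonneg ‖g‖]
  · have h1 := hup g
    rw [hd4] at h1
    nlinarith [sq_nonneg ‖g‖]
  · refine inner_colComb_le_of_sketchSq_le hpos (by linarith [norm_nonneg H]) fun z => ?_
    have h1 := hup (H z)
    have h2 := norm_sq_le_of_inner_le hs hpos hnormle z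
    rw [hd4] at h1
    have h3 := hpos z
    calc sketchSq S (H z) ≤ (5 / 4 + d / k / 4) * ‖H z‖ ^ 2 := h1
      _ ≤ 2 * ‖H z‖ ^ 2 := by gcongr; linarith
      _ ≤ 2 * (‖H‖ * inner ℝ (H z) z) := by gcongr
      _ = (2 * ‖H‖) * inner ℝ (H z) z := by ring
      _ ≤ C₁ * inner ℝ (H z) z := by gcongr; linarith [norm_nonneg H]

/-- The number of columns is at least `8` whenever the dimension is. -/
theorem exists_matrix_eight_le (hd : 8 ≤ d) {k : ℝ} (hk : 40 ≤ k) :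
    ∃ A : Matrix (Fin d) (Fin d) ℝ, ∀ S : Matrix (Fin d) (Fin l) ℝ,
      spectralNorm₂ (Aᵀ * S * Sᵀ * A - Aᵀ * A) ≤
        1 / 4 * (spectralNorm₂ A ^ 2 + frobeniusSq A / k) → 8 ≤ l := by
  have hk0 : 0 < k := by linarith
  -- The test matrix is the projection onto eight coordinates. With fewer than eight columns some
  -- nonzero `w` in its range satisfies `Sᵀ w = 0`, so the sketch loses all of `‖w‖²`.
  set p : Fin d → ℝ := fun i => if (i : ℕ) < 8 then 1 else 0 with hp
  refine ⟨Matrix.diagonal p, fun S hS => ?_⟩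
  by_contra! hl
  have hspec : spectralNorm₂ (Matrix.diagonal p) ≤ 1 := by
    refine ContinuousLinearMap.opNorm_le_bound _ zero_le_one fun w => ?_
    refine le_of_sq_le_sq ?_ (by positivity)
    rw [one_mul, EuclideanSpace.real_norm_sq_eq, EuclideanSpace.real_norm_sq_eq]
    refine Finset.sum_le_sum fun i _ => ?_
    rw [Matrix.ofLp_toEuclideanCLM, Matrix.mulVec_diagonal]
    simp only [hp]
    split_ifs
    · simp
    · simpa using sq_nonneg _
  have hfro : frobeniusSq (Matrix.diagonal p) = 8 := by
    have h1 : frobeniusSq (Matrix.diagonal p) = ∑ i : Fin d, if (i : ℕ) < 8 then (1 : ℝ) else 0 := by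
      refine Finset.sum_congr rfl fun i _ => ?_
      rw [Finset.sum_eq_single i]
      · simp [hp]
      · intro j _ hj
        simp [Matrix.diagonal_apply_ne _ hj.symm]
      · simp
    rw [h1, Fin.sum_univ_eq_sum_range (fun i => if i < 8 then (1 : ℝ) else 0) d,
      Finset.sum_ite, Finset.sum_const_zero, add_zero, Finset.sum_const]
    have : (Finset.range d).filter (fun i => i < 8) = Finset.range 8 := by
      ext i; simp only [Finset.mem_filter, Finset.mem_range]; omega
    rw [this]
    simp
  set N : Matrix (Fin l) (Fin 8) ℝ := fun i j => S (Fin.castLE hd j) i with hN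
  have hker : LinearMap.ker N.mulVecLin ≠ ⊥ := LinearMap.ker_ne_bot_of_finrank_lt (by simpa using hl)
  obtain ⟨u, hu, hu0⟩ := Submodule.exists_mem_ne_zero_of_ne_bot hker
  set w : Eucl d := WithLp.toLp 2 (fun i => if h : (i : ℕ) < 8 then u ⟨i, h⟩ else 0) with hw
  have hAw : Matrix.toEuclideanCLM (n := Fin d) (𝕜 := ℝ) (Matrix.diagonal p) w = w := by
    ext i
    rw [Matrix.ofLp_toEuclideanCLM, Matrix.mulVec_diagonal]
    simp only [hp, hw]
    split_ifs <;> simp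
  have hsk : sketchSq S w = 0 := by
    refine Finset.sum_eq_zero fun i _ => ?_
    have h1 : (N *ᵥ u) i = 0 := by
      have : N.mulVecLin u = 0 := hu
      rw [Matrix.mulVecLin_apply] at this
      rw [this]; rfl
    have h2 : (inner ℝ (matCol S i) w : ℝ) = (N *ᵥ u) i := by
      rw [EuclideanSpace.inner_eq_star_dotProduct]
      simp only [Matrix.mulVec, dotProduct, hN, hw, matCol]
      symm
      refine Finset.sum_of_injOn (Fin.castLE hd) (Fin.castLE_injective hd).injOn (by simp) ?_ ?_
      · intro j _ hj
        have : ¬ (j : ℕ) < 8 := fun hj8 => hj ⟨⟨j, hj8⟩, by simp, by ext; simp⟩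
        simp [this]
      · intro j _
        simp [mul_comm]
    rw [h2, h1]; norm_num
  have hw0 : w ≠ 0 := by
    intro h0
    apply hu0
    ext j
    have := congrArg (fun v : Eucl d => v (Fin.castLE hd j)) h0
    simpa [hw] using this
  have h1 := abs_sketchSq_sub_le hS w
  rw [hAw, hsk, hfro, zero_sub, abs_neg, abs_of_nonneg (sq_nonneg _)] at h1
  have h2 : 0 < ‖w‖ ^ 2 := by have := norm_pos_iff.2 hw0; positivity
  -- The event allows an error of at most `(1 + 8 / k) / 4 ≤ 1 / 2` times `‖w‖²`, a contradiction.
  have h3 : 8 / k ≤ 1 := by rw [div_le_one hk0]; linarith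
  have h4 : spectralNorm₂ (Matrix.diagonal p) ^ 2 ≤ 1 := pow_le_one₀ (norm_nonneg _) hspec
  nlinarith

end Sketch

/-! ### Decrease of the objective in one step -/

section Step

variable {d l : ℕ}

theorem rpow_div_two_eq_sqrt_pow {a : ℝ} (ha : 0 ≤ a) (n : ℕ) : a ^ ((n : ℝ) / 2) = √a ^ n := by
  rw [Real.sqrt_eq_rpow, ← Real.rpow_natCast, ← Real.rpow_mul ha]
  congr 1
  ring

/-- This splits `C₄` into the oracle noise `X = √ℓ σ / α` and the discretization error `Y = Lh α²
C₃^(3/2) / 6`, the two quantities that bound the finite difference errors. -/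
theorem mul_constC4 (l : ℕ) {C₁ C₂ C₃ μ Lh σ α : ℝ} (hμ : 0 < μ) (hC₃ : 0 ≤ C₃) :
    μ * constC4 l C₁ C₂ C₃ μ Lh σ α =
      20 * ((√l * σ / α) ^ 2 + (Lh * α ^ 2 * √C₃ ^ 3 / 6) ^ 2) +
      8 * (Lh * C₂ ^ 3 / (3 * C₁ ^ 2)) *
        ((√l * σ / α) ^ 3 + (Lh * α ^ 2 * √C₃ ^ 3 / 6) ^ 3) := by
  have h1 : C₃ ^ (9 / 2 : ℝ) = √C₃ ^ 9 := by
    simpa using rpow_div_two_eq_sqrt_pow hC₃ 9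
  have h2 : (l : ℝ) ^ (3 / 2 : ℝ) = √l ^ 3 := by
    simpa using rpow_div_two_eq_sqrt_pow (Nat.cast_nonneg l : (0 : ℝ) ≤ l) 3
  have h3 : √(l : ℝ) ^ 2 = l := Real.sq_sqrt (Nat.cast_nonneg l)
  have h4 : √C₃ ^ 2 = C₃ := Real.sq_sqrt hC₃
  have h5 : (√C₃ ^ 3) ^ 2 = C₃ ^ 3 := by rw [← pow_mul, mul_comm, pow_mul, h4]
  unfold constC4
  rw [h1, h2, div_pow (√(l : ℝ) * σ) α 2, mul_pow (√(l : ℝ)) σ 2, h3,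
    div_pow (Lh * α ^ 2 * √C₃ ^ 3) 6 2, mul_pow _ (√C₃ ^ 3) 2, h5]
  field_simp
  ring

theorem sum_pow_three_le {ι : Type*} (s : Finset ι) (a : ι → ℝ) (ha : ∀ i, 0 ≤ a i) :
    ∑ i ∈ s, a i ^ 3 ≤ (∑ i ∈ s, a i) ^ 3 := by
  have h : ∀ i ∈ s, a i ≤ ∑ j ∈ s, a j := fun i hi =>
    Finset.single_le_sum (fun j _ => ha j) hi
  have h0 : 0 ≤ ∑ j ∈ s, a j := Finset.sum_nonneg fun j _ => ha j
  calc ∑ i ∈ s, a i ^ 3 ≤ ∑ i ∈ s, (∑ j ∈ s, a j) ^ 2 * a i := by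
        refine Finset.sum_le_sum fun i hi => ?_
        rw [pow_succ]
        exact mul_le_mul_of_nonneg_right (pow_le_pow_left₀ (ha i) (h i hi) 2) (ha i)
    _ = _ := by rw [← Finset.mul_sum]; ring

theorem sum_norm_matCol_sq (S : Matrix (Fin d) (Fin l) ℝ) :
    ∑ i, ‖matCol S i‖ ^ 2 = frobeniusSq S := by
  unfold frobeniusSq
  rw [Finset.sum_comm]
  refine Finset.sum_congr rfl fun i _ => ?_
  rw [EuclideanSpace.real_norm_sq_eq]
  rfl

theorem sum_norm_matCol_pow_six_le_of_frobeniusSq {S : Matrix (Fin d) (Fin l) ℝ} {C : ℝ}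
    (h : frobeniusSq S = C) : ∑ i, ‖matCol S i‖ ^ 6 ≤ C ^ 3 := by
  rw [← h, ← sum_norm_matCol_sq]
  refine le_trans (le_of_eq ?_) (sum_pow_three_le Finset.univ (fun i => ‖matCol S i‖ ^ 2)
    fun i => sq_nonneg _)
  refine Finset.sum_congr rfl fun i _ => ?_
  rw [← pow_mul]

/-- Testing the bound on the column itself, the single term `‖s‖⁴` of the sum is at most `Q ‖s‖²`.
-/
theorem norm_matCol_sq_le {S : Matrix (Fin d) (Fin l) ℝ} {Q : ℝ} (hQ : 0 ≤ Q)
    (h : ∀ v, sketchSq S v ≤ Q * ‖v‖ ^ 2) (i : Fin l) : ‖matCol S i‖ ^ 2 ≤ Q := by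
  have h1 := h (matCol S i)
  have h2 : (inner ℝ (matCol S i) (matCol S i) : ℝ) ^ 2 ≤ sketchSq S (matCol S i) :=
    Finset.single_le_sum (f := fun j => (inner ℝ (matCol S j) (matCol S i) : ℝ) ^ 2)
      (fun j _ => sq_nonneg _) (Finset.mem_univ i)
  rw [real_inner_self_eq_norm_sq] at h2
  rcases eq_or_ne (matCol S i) 0 with h0 | h0
  · simpa [h0] using hQ
  · have h3 : 0 < ‖matCol S i‖ ^ 2 := by have := norm_pos_iff.2 h0; positivity
    have h4 : ‖matCol S i‖ ^ 2 * ‖matCol S i‖ ^ 2 ≤ Q * ‖matCol S i‖ ^ 2 := by nlinarith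
    exact le_of_mul_le_mul_right h4 h3

theorem sum_norm_matCol_pow_six_le {S : Matrix (Fin d) (Fin l) ℝ} {Q C : ℝ} (hQ : 0 ≤ Q)
    (h : ∀ v, sketchSq S v ≤ Q * ‖v‖ ^ 2) (hC : l * Q ^ 3 ≤ C) :
    ∑ i, ‖matCol S i‖ ^ 6 ≤ C := by
  refine le_trans ?_ hC
  calc ∑ i, ‖matCol S i‖ ^ 6 ≤ ∑ _i : Fin l, Q ^ 3 := by
        refine Finset.sum_le_sum fun i _ => ?_
        calc ‖matCol S i‖ ^ 6 = (‖matCol S i‖ ^ 2) ^ 3 := by ring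
          _ ≤ Q ^ 3 := pow_le_pow_left₀ (sq_nonneg _) (norm_matCol_sq_le hQ h i) 3
    _ = l * Q ^ 3 := by simp

/-- The error of the finite difference along the `i`-th column. -/
noncomputable def diffError (φ f : Eucl d → ℝ) (α : ℝ) (x : Eucl d) (S : Matrix (Fin d) (Fin l) ℝ)
    (i : Fin l) : ℝ :=
  (f (x + α • matCol S i) - f (x - α • matCol S i)) / (2 * α) -
    inner ℝ (matCol S i) (gradient φ x)

theorem abs_diffError_le {φ f : Eucl d → ℝ} (h : ContDiff ℝ 2 φ) {Lh α σ : ℝ} (hα : 0 < α)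
    (hH : HasLipschitzHessian φ Lh) (hf : ∀ x, |f x - φ x| ≤ σ) (x : Eucl d)
    (S : Matrix (Fin d) (Fin l) ℝ) (i : Fin l) :
    |diffError φ f α x S i| ≤ σ / α + Lh * α ^ 2 / 6 * ‖matCol S i‖ ^ 3 := by
  set s := matCol S i with hs
  have h1 := abs_central_difference_sub_le h hα hH x s
  have h2 := hf (x + α • s)
  have h3 := hf (x - α • s)
  have h4 : |(f (x + α • s) - φ (x + α • s) - (f (x - α • s) - φ (x - α • s))) / (2 * α)| ≤
      σ / α := by
    rw [abs_div, abs_of_pos (by positivity : 0 < 2 * α), div_le_div_iff₀ (by positivity) hα]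
    have := (abs_sub _ _).trans (add_le_add h2 h3)
    nlinarith
  have e : diffError φ f α x S i =
      (f (x + α • s) - φ (x + α • s) - (f (x - α • s) - φ (x - α • s))) / (2 * α) +
      ((φ (x + α • s) - φ (x - α • s)) / (2 * α) - inner ℝ (gradient φ x) s) := by
    rw [diffError, real_inner_comm]
    ring
  rw [e]
  exact (abs_add_le _ _).trans (add_le_add h4 h1)

theorem sum_diffError_sq_le {φ f : Eucl d → ℝ} (h : ContDiff ℝ 2 φ) {Lh α σ C₃ : ℝ} (hα : 0 < α)
    (hH : HasLipschitzHessian φ Lh) (hf : ∀ x, |f x - φ x| ≤ σ)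
    (x : Eucl d) {S : Matrix (Fin d) (Fin l) ℝ} (hC₃ : 0 ≤ C₃)
    (h6 : ∑ i, ‖matCol S i‖ ^ 6 ≤ C₃ ^ 3) :
    ∑ i, diffError φ f α x S i ^ 2 ≤
      2 * ((√l * σ / α) ^ 2 + (Lh * α ^ 2 * √C₃ ^ 3 / 6) ^ 2) := by
  have h1 : ∀ i, diffError φ f α x S i ^ 2 ≤
      2 * (σ / α) ^ 2 + 2 * (Lh * α ^ 2 / 6) ^ 2 * ‖matCol S i‖ ^ 6 := fun i => by
    have h2 := abs_diffError_le h hα hH hf x S i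
    have h3 : diffError φ f α x S i ^ 2 ≤ (σ / α + Lh * α ^ 2 / 6 * ‖matCol S i‖ ^ 3) ^ 2 := by
      rw [← sq_abs]
      exact pow_le_pow_left₀ (abs_nonneg _) h2 2
    nlinarith [sq_nonneg (σ / α - Lh * α ^ 2 / 6 * ‖matCol S i‖ ^ 3)]
  have h3 : √(l : ℝ) ^ 2 = l := Real.sq_sqrt (Nat.cast_nonneg l)
  have h5 : (√C₃ ^ 3) ^ 2 = C₃ ^ 3 := by rw [← pow_mul, mul_comm, pow_mul, Real.sq_sqrt hC₃]
  calc _ ≤ ∑ i, (2 * (σ / α) ^ 2 + 2 * (Lh * α ^ 2 / 6) ^ 2 * ‖matCol S i‖ ^ 6) :=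
        Finset.sum_le_sum fun i _ => h1 i
    _ = l * (2 * (σ / α) ^ 2) + 2 * (Lh * α ^ 2 / 6) ^ 2 * ∑ i, ‖matCol S i‖ ^ 6 := by
        rw [Finset.sum_add_distrib, ← Finset.mul_sum _ _ (2 * (Lh * α ^ 2 / 6) ^ 2)]; simp
    _ ≤ l * (2 * (σ / α) ^ 2) + 2 * (Lh * α ^ 2 / 6) ^ 2 * C₃ ^ 3 := by gcongr
    _ = _ := by
        rw [div_pow (√(l : ℝ) * σ) α 2, mul_pow (√(l : ℝ)) σ 2, h3,
          div_pow (Lh * α ^ 2 * √C₃ ^ 3) 6 2, mul_pow _ (√C₃ ^ 3) 2, h5]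
        ring

theorem pow_three_le_of_sq_le {m X Y : ℝ} (hX : 0 ≤ X) (hY : 0 ≤ Y)
    (h : m ^ 2 ≤ 2 * (X ^ 2 + Y ^ 2)) : m ^ 3 ≤ 4 * (X ^ 3 + Y ^ 3) := by
  refine le_of_sq_le_sq ?_ (by positivity)
  have h1 : (m ^ 2) ^ 3 ≤ (2 * (X ^ 2 + Y ^ 2)) ^ 3 := pow_le_pow_left₀ (sq_nonneg _) h 3
  -- This product is exactly `2 (X³ + Y³)² - (X² + Y²)³`.
  have h2 : 0 ≤ (X - Y) ^ 2 * (X ^ 4 + 2 * X ^ 3 * Y + 2 * X * Y ^ 3 + Y ^ 4) := by positivity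
  nlinarith

/-- One step along `S` from `x` with step size `η`. -/
noncomputable def zoStep (f : Eucl d → ℝ) (α η : ℝ) (x : Eucl d)
    (S : Matrix (Fin d) (Fin l) ℝ) : Eucl d :=
  x - η • colComb S fun i => (f (x + α • matCol S i) - f (x - α • matCol S i)) / (2 * α)

theorem norm_colComb_sq_le {S : Matrix (Fin d) (Fin l) ℝ} {Q : ℝ} (hQ : 0 ≤ Q)
    (h : ∀ v, sketchSq S v ≤ Q * ‖v‖ ^ 2) (u : Fin l → ℝ) :
    ‖colComb S u‖ ^ 2 ≤ Q * ∑ i, u i ^ 2 := by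
  have := inner_colComb_le_of_sketchSq_le (S := S) (G := ContinuousLinearMap.id ℝ (Eucl d))
    (fun v => by simp) hQ (fun z => by simpa using h z) u
  simpa using this

/-- Here `n = ‖Sᵀ g‖`, `m = ‖e‖` and `U = ‖Sᵀ g + e‖`. The bound on `κ n` turns all cubic terms
except `κ m³` into quadratic ones. -/
theorem local_step_scalar {n m ip κ U : ℝ} (hn : 0 ≤ n) (hm : 0 ≤ m)
    (hip : |ip| ≤ n * m) (hκ : 0 ≤ κ) (hκn : κ * n ≤ 1 / 6) (hU0 : 0 ≤ U)
    (hU : U ^ 2 = n ^ 2 + 2 * ip + m ^ 2) :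
    -(n ^ 2 + ip) + U ^ 2 / 4 + κ * U ^ 3 ≤ -(52 / 100) * n ^ 2 + 5 * m ^ 2 + κ * m ^ 3 := by
  obtain ⟨h1, h2⟩ := abs_le.1 hip
  have hUle : U ≤ n + m := le_of_sq_le_sq (by nlinarith) (by positivity)
  have h3 : κ * U ^ 3 ≤ κ * (n + m) ^ 3 := by gcongr
  have h4 : κ * (n + m) ^ 3 = (κ * n) * (n ^ 2 + 3 * n * m + 3 * m ^ 2) + κ * m ^ 3 := by ring
  have h5 : (κ * n) * (n ^ 2 + 3 * n * m + 3 * m ^ 2) ≤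
      1 / 6 * (n ^ 2 + 3 * n * m + 3 * m ^ 2) := by gcongr
  -- What remains is `-(7/12) n² + n m + (3/4) m²`, and the square gives `n m ≤ n² / 16 + 4 m²`.
  nlinarith [sq_nonneg (n - 8 * m)]

theorem sum_sq_add {ι : Type*} [Fintype ι] (a e : ι → ℝ) :
    ∑ i, (a i + e i) ^ 2 = ∑ i, a i ^ 2 + 2 * ∑ i, a i * e i + ∑ i, e i ^ 2 := by
  rw [Finset.mul_sum, ← Finset.sum_add_distrib, ← Finset.sum_add_distrib]
  exact Finset.sum_congr rfl fun i _ => by ring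

theorem zoStep_eq (φ f : Eucl d → ℝ) (α η : ℝ) (x : Eucl d) (S : Matrix (Fin d) (Fin l) ℝ) :
    zoStep f α η x S = x + -(η • colComb S fun i =>
      inner ℝ (matCol S i) (gradient φ x) + diffError φ f α x S i) := by
  rw [zoStep, sub_eq_add_neg]
  congr 4
  funext i
  rw [diffError]
  ring

theorem inner_gradient_colComb (φ : Eucl d → ℝ) (x : Eucl d) (S : Matrix (Fin d) (Fin l) ℝ)
    (e : Fin l → ℝ) :
    (inner ℝ (gradient φ x)
      (colComb S fun i => inner ℝ (matCol S i) (gradient φ x) + e i) : ℝ) =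
      sketchSq S (gradient φ x) + ∑ i, inner ℝ (matCol S i) (gradient φ x) * e i := by
  rw [real_inner_comm, inner_colComb, sketchSq, ← Finset.sum_add_distrib]
  exact Finset.sum_congr rfl fun i _ => by ring

/-- The decrease of `φ` in one step inside the local region. -/
theorem local_step {φ f : Eucl d → ℝ} (h : ContDiff ℝ 2 φ) {μ L Lh α σ C₁ C₂ C₃ Q : ℝ}
    (hμ : 0 < μ) (hL0 : 0 < L) (hLh : 0 < Lh) (hα : 0 < α) (hσ : 0 ≤ σ) (hC₁ : 0 < C₁)
    (hC₂ : 0 < C₂) (hC₃ : 0 ≤ C₃) (hQ0 : 0 ≤ Q) (hQ : Q ≤ 4 * C₂ ^ 2)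
    (hc : IsStronglyConvex φ μ) (hL : IsSmoothWith φ L) (hH : HasLipschitzHessian φ Lh)
    (hf : ∀ x, |f x - φ x| ≤ σ) {x xstar : Eucl d} (hmin : IsMinOn φ Set.univ xstar)
    {S : Matrix (Fin d) (Fin l) ℝ}
    (hS : IsGoodSketch S Q (gradient φ x) (hessian φ x) C₁)
    (h6 : ∑ i, ‖matCol S i‖ ^ 6 ≤ C₃ ^ 3)
    (hr : √(φ x - φ xstar) ≤ localRadius C₁ C₂ L Lh) :
    φ (zoStep f α (1 / (2 * C₁)) x S) - φ xstar - constC4 l C₁ C₂ C₃ μ Lh σ α ≤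
      (1 - μ / (4 * C₁)) * (φ x - φ xstar - constC4 l C₁ C₂ C₃ μ Lh σ α) := by
  set η := 1 / (2 * C₁) with hη
  have hη0 : 0 < η := by positivity
  set g := gradient φ x with hg
  set e := diffError φ f α x S with he
  set D := φ x - φ xstar with hD
  have hD0 : 0 ≤ D := sub_nonneg.2 (hmin (Set.mem_univ x))
  set u : Fin l → ℝ := fun i => inner ℝ (matCol S i) g + e i with hu
  set v := colComb S u with hv
  set κ := Lh * C₂ ^ 3 / (3 * C₁ ^ 2) with hκ
  have hκ0 : 0 ≤ κ := by positivity
  set X := √(l : ℝ) * σ / α with hX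
  set Y := Lh * α ^ 2 * √C₃ ^ 3 / 6 with hY
  have hX0 : 0 ≤ X := by positivity
  have hY0 : 0 ≤ Y := by positivity
  have hC4 := mul_constC4 l (C₁ := C₁) (C₂ := C₂) (Lh := Lh) (σ := σ) (α := α) hμ hC₃
  rw [← hX, ← hY, ← hκ] at hC4
  set C := constC4 l C₁ C₂ C₃ μ Lh σ α with hC
  have hsum0 : 0 ≤ ∑ i, u i ^ 2 := Finset.sum_nonneg fun i _ => sq_nonneg _
  have hsume0 : 0 ≤ ∑ i, e i ^ 2 := Finset.sum_nonneg fun i _ => sq_nonneg _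
  have hsk0 : 0 ≤ sketchSq S g := Finset.sum_nonneg fun i _ => sq_nonneg _
  set U := √(∑ i, u i ^ 2) with hU
  set n := √(sketchSq S g) with hn
  set m := √(∑ i, e i ^ 2) with hm
  have hU2 : U ^ 2 = ∑ i, u i ^ 2 := Real.sq_sqrt hsum0
  have hn2 : n ^ 2 = sketchSq S g := Real.sq_sqrt hsk0
  have hm2 : m ^ 2 = ∑ i, e i ^ 2 := Real.sq_sqrt hsume0
  have hn0 : 0 ≤ n := Real.sqrt_nonneg _
  have hm0 : 0 ≤ m := Real.sqrt_nonneg _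
  have hU0 : 0 ≤ U := Real.sqrt_nonneg _
  set ip := ∑ i, inner ℝ (matCol S i) g * e i with hip
  have hip1 : |ip| ≤ n * m := by
    refine abs_le_of_sq_le_sq ?_ (by positivity)
    rw [mul_pow, hn2, hm2]
    exact Finset.sum_mul_sq_le_sq_mul_sq _ _ _
  have hUe : U ^ 2 = n ^ 2 + 2 * ip + m ^ 2 := by
    rw [hU2, hn2, hm2]
    exact sum_sq_add _ _
  have hgle := norm_gradient_sq_le hL0 hL hmin x
  have hgge := le_norm_gradient_sq hμ hc x xstar
  rw [← hg, ← hD] at hgle hgge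
  have hDr : D ≤ localRadius C₁ C₂ L Lh ^ 2 := by
    rw [← Real.sq_sqrt hD0]
    exact pow_le_pow_left₀ (Real.sqrt_nonneg _) hr 2
  -- The local radius is tuned for this: `‖g‖² ≤ 2 L r²` and the upper gradient bound give `(κ n)² ≤
  -- 1.5125 / 64 < 1 / 36`.
  have hκn : κ * n ≤ 1 / 6 := by
    refine le_of_sq_le_sq ?_ (by norm_num)
    rw [mul_pow, hn2]
    have h1 : sketchSq S g ≤ 15125 / 10000 * (2 * L * localRadius C₁ C₂ L Lh ^ 2) := by
      refine hS.grad_upper.trans ?_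
      gcongr
      exact hgle.trans (by gcongr)
    have h2 : κ ^ 2 * (15125 / 10000 * (2 * L * localRadius C₁ C₂ L Lh ^ 2)) =
        15125 / 10000 / 64 := by
      have e1 : √(2 : ℝ) ^ 2 = 2 := Real.sq_sqrt (by norm_num)
      have e2 : √L ^ 2 = L := Real.sq_sqrt hL0.le
      have e3 : localRadius C₁ C₂ L Lh ^ 2 = 9 * 2 * C₁ ^ 4 / (256 * L * Lh ^ 2 * C₂ ^ 6) := by
        unfold localRadius
        rw [div_pow]
        congr 1
        · calc _ = 9 * √(2 : ℝ) ^ 2 * C₁ ^ 4 := by ring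
            _ = _ := by rw [e1]
        · calc _ = 256 * √L ^ 2 * Lh ^ 2 * C₂ ^ 6 := by ring
            _ = _ := by rw [e2]
      rw [e3, hκ]
      field_simp
      norm_num
    calc κ ^ 2 * sketchSq S g ≤ _ := mul_le_mul_of_nonneg_left h1 (sq_nonneg _)
      _ = 15125 / 10000 / 64 := h2
      _ ≤ (1 / 6) ^ 2 := by norm_num
  have hscal := local_step_scalar hn0 hm0 hip1 hκ0 hκn hU0 hUe
  have htay := (abs_le.1 (abs_taylor_of_lipschitz_hessian h hH x (-(η • v)))).2
  rw [inner_neg_right, map_neg, inner_neg_neg, map_smul, inner_smul_right, inner_smul_right,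
    inner_smul_left, inner_gradient_colComb, norm_neg, norm_smul, Real.norm_eq_abs,
    abs_of_pos hη0, ← hip, ← hn2] at htay
  simp only [conj_trivial] at htay
  have hhess := hS.hess u
  rw [← hv, ← hU2] at hhess
  have hvn : ‖v‖ ≤ 2 * C₂ * U := by
    refine le_of_sq_le_sq ?_ (by positivity)
    have := norm_colComb_sq_le hQ0 hS.upper u
    rw [← hv, ← hU2] at this
    calc _ ≤ Q * U ^ 2 := this
      _ ≤ 4 * C₂ ^ 2 * U ^ 2 := by gcongr
      _ = _ := by ring
  have hcub : Lh / 6 * (η * ‖v‖) ^ 3 ≤ η * (κ * U ^ 3) := by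
    calc Lh / 6 * (η * ‖v‖) ^ 3 ≤ Lh / 6 * (η * (2 * C₂ * U)) ^ 3 := by gcongr
      _ = η * (κ * U ^ 3) := by
        rw [hκ, hη]; field_simp; ring
  have hquad : η * (η * inner ℝ (hessian φ x v) v) / 2 ≤ η * (U ^ 2 / 4) := by
    calc η * (η * inner ℝ (hessian φ x v) v) / 2 ≤ η * (η * (C₁ * U ^ 2)) / 2 := by gcongr
      _ = η * (U ^ 2 / 4) := by rw [hη]; field_simp; ring
  have hmsq : m ^ 2 ≤ 2 * (X ^ 2 + Y ^ 2) := by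
    rw [hm2]; exact sum_diffError_sq_le h hα hH hf x hC₃ h6
  have hm3 := pow_three_le_of_sq_le hX0 hY0 hmsq
  -- Since `m² ≤ 2 (X² + Y²)` and `m³ ≤ 4 (X³ + Y³)`, the left side is at most half of
  -- `mul_constC4`.
  have hnoise : 5 * m ^ 2 + κ * m ^ 3 ≤ μ * C / 2 := by
    have := mul_le_mul_of_nonneg_left hm3 hκ0
    rw [hC4]
    linarith
  -- The lower gradient bound and the Polyak–Łojasiewicz inequality combine to `0.52 · 0.485 · 2 > 1
  -- / 2`.
  have hdec : -(52 / 100) * n ^ 2 ≤ - (μ * D / 2) := by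
    have := hS.grad_lower
    rw [← hn2] at this
    have h0 : 0 ≤ μ * D := by positivity
    linarith
  rw [zoStep_eq φ f]
  have hfin : φ (x + -(η • v)) - φ x ≤ η * (μ * C / 2 - μ * D / 2) := by
    have h1 : φ (x + -(η • v)) - φ x ≤ η * (-(n ^ 2 + ip) + U ^ 2 / 4 + κ * U ^ 3) := by
      linarith
    refine h1.trans (mul_le_mul_of_nonneg_left ?_ hη0.le)
    linarith
  have e4 : μ / (4 * C₁) = η * μ / 2 := by rw [hη]; field_simp; norm_num
  rw [e4]
  have : φ (x + -(η • v)) ≤ φ x + η * (μ * C / 2 - μ * D / 2) := by linarith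
  have e5 : φ x = D + φ xstar := by rw [hD]; ring
  linarith

/-- The decrease of `φ` in one step with the small step size. -/
theorem global_step {φ f : Eucl d → ℝ} (h : ContDiff ℝ 2 φ) {μ L Lh α σ C₁ C₂ C₃ Q η : ℝ}
    (hμ : 0 < μ) (hL0 : 0 < L) (hLh : 0 < Lh) (hα : 0 < α) (hσ : 0 ≤ σ)
    (hC₂ : 0 < C₂) (hC₃ : 0 ≤ C₃) (hQ0 : 0 ≤ Q) (hQ : Q ≤ 4 * C₂ ^ 2)
    (hc : IsStronglyConvex φ μ) (hL : IsSmoothWith φ L) (hH : HasLipschitzHessian φ Lh)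
    (hf : ∀ x, |f x - φ x| ≤ σ) {x xstar : Eucl d} (hmin : IsMinOn φ Set.univ xstar)
    {S : Matrix (Fin d) (Fin l) ℝ}
    (hS : IsGoodSketch S Q (gradient φ x) (hessian φ x) C₁)
    (h6 : ∑ i, ‖matCol S i‖ ^ 6 ≤ C₃ ^ 3) (hη0 : 0 < η) (hη : η * L * (4 * C₂ ^ 2) ≤ 1) :
    φ (zoStep f α η x S) - φ xstar ≤
      (1 - 2 / 5 * (η * μ)) * (φ x - φ xstar) +
        2 / 5 * (η * μ) * (constC4 l C₁ C₂ C₃ μ Lh σ α / 2) := by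
  set g := gradient φ x with hg
  set e := diffError φ f α x S with he
  set D := φ x - φ xstar with hD
  have hD0 : 0 ≤ D := sub_nonneg.2 (hmin (Set.mem_univ x))
  set u : Fin l → ℝ := fun i => inner ℝ (matCol S i) g + e i with hu
  set v := colComb S u with hv
  set X := √(l : ℝ) * σ / α with hX
  set Y := Lh * α ^ 2 * √C₃ ^ 3 / 6 with hY
  have hX0 : 0 ≤ X := by positivity
  have hY0 : 0 ≤ Y := by positivity
  have hC4 := mul_constC4 l (C₁ := C₁) (C₂ := C₂) (Lh := Lh) (σ := σ) (α := α) hμ hC₃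
  rw [← hX, ← hY] at hC4
  set C := constC4 l C₁ C₂ C₃ μ Lh σ α with hC
  have hCle : 20 * (X ^ 2 + Y ^ 2) ≤ μ * C := by
    rw [hC4]
    have : 0 ≤ 8 * (Lh * C₂ ^ 3 / (3 * C₁ ^ 2)) * (X ^ 3 + Y ^ 3) := by positivity
    linarith
  have hsum0 : 0 ≤ ∑ i, u i ^ 2 := Finset.sum_nonneg fun i _ => sq_nonneg _
  have hUe : ∑ i, u i ^ 2 = sketchSq S g + 2 * ∑ i, inner ℝ (matCol S i) g * e i +
      ∑ i, e i ^ 2 := sum_sq_add _ _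
  have hgge := le_norm_gradient_sq hμ hc x xstar
  rw [← hg, ← hD] at hgge
  have hsm := hL x (x + -(η • v))
  rw [add_sub_cancel_left, inner_neg_right, inner_smul_right, inner_gradient_colComb, norm_neg,
    norm_smul, Real.norm_eq_abs, abs_of_pos hη0] at hsm
  have hvn : ‖v‖ ^ 2 ≤ 4 * C₂ ^ 2 * ∑ i, u i ^ 2 :=
    (norm_colComb_sq_le hQ0 hS.upper u).trans (by gcongr)
  have hquad : L / 2 * (η * ‖v‖) ^ 2 ≤ η / 2 * ∑ i, u i ^ 2 := by
    calc L / 2 * (η * ‖v‖) ^ 2 = η / 2 * (η * L) * ‖v‖ ^ 2 := by ring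
      _ ≤ η / 2 * (η * L) * (4 * C₂ ^ 2 * ∑ i, u i ^ 2) := by gcongr
      _ = η / 2 * ((η * L * (4 * C₂ ^ 2)) * ∑ i, u i ^ 2) := by ring
      _ ≤ η / 2 * (1 * ∑ i, u i ^ 2) := by gcongr
      _ = _ := by ring
  have hmsq : ∑ i, e i ^ 2 ≤ 2 * (X ^ 2 + Y ^ 2) := sum_diffError_sq_le h hα hH hf x hC₃ h6
  have hlow := hS.grad_lower
  rw [zoStep_eq φ f]
  have h1 : φ (x + -(η • v)) ≤ φ x + η * (-(2 / 5) * μ * D + 2 / 5 * μ * (C / 2)) := by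
    -- The cross term `⟨Sᵀ g, e⟩` cancels exactly between the linear and the quadratic part.
    have h2 : φ (x + -(η • v)) ≤ φ x + η * (-(1 / 2) * sketchSq S g + 1 / 2 * ∑ i, e i ^ 2) := by
      rw [hUe] at hquad
      linarith
    refine h2.trans (add_le_add le_rfl (mul_le_mul_of_nonneg_left ?_ hη0.le))
    have h0 : 0 ≤ μ * D := by positivity
    have h3 : 0 ≤ X ^ 2 + Y ^ 2 := by positivity
    linarith
  have e5 : φ x = D + φ xstar := by rw [hD]; ring
  linarith

end Step

/-! ### Two-phase convergence and the query count -/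

section Iteration

/-- Two-phase linear convergence: a sequence that contracts at rate `q` down to the floor `C / 2`
outside the radius `R`, and at rate `p` down to the floor `C` inside of it. -/
theorem le_add_of_two_phase {D : ℕ → ℝ} {C R p q ε : ℝ} {T T₁ : ℕ} (hC : 0 ≤ C)
    (hR : 0 < R) (hp0 : 0 < p) (hp1 : p ≤ 1) (hq0 : 0 < q) (hq1 : q ≤ 1)
    (hε : 0 < ε) (hD0 : 0 ≤ D 0)
    (hlocal : ∀ t < T, D t ≤ R → D (t + 1) - C ≤ (1 - p) * (D t - C))
    (hglobal : ∀ t < T, R < D t → D (t + 1) ≤ (1 - q) * D t + q * (C / 2))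
    (hT₁ : T₁ ≤ T) (h1 : D 0 * Real.exp (-(q / 2 * T₁)) ≤ R)
    (h2 : D 0 * Real.exp (-(p * (T - T₁ : ℕ))) ≤ ε) : D T ≤ C + ε := by
  -- The sublevel `C + ε` is invariant. If the last iterate lies above it, so do all earlier ones,
  -- and this is what makes the sequence decrease below.
  have hstep : ∀ t < T, D t ≤ C + ε → D (t + 1) ≤ C + ε := by
    intro t ht hle
    rcases le_or_gt (D t) R with hr | hr
    · have := hlocal t ht hr
      nlinarith
    · have := hglobal t ht hr
      nlinarith
  by_contra! hcon
  have hall : ∀ t ≤ T, C + ε < D t := by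
    intro t ht
    by_contra! hle
    have : ∀ s, t + s ≤ T → D (t + s) ≤ C + ε := by
      intro s
      induction s with
      | zero => intro _; exact hle
      | succ s ih => intro hs; exact hstep (t + s) (by omega) (ih (by omega))
    have := this (T - t) (by omega)
    rw [Nat.add_sub_cancel' ht] at this
    linarith
  -- The floor `C / 2` matters here: above `C` it costs at most half of the rate, so the contraction
  -- is towards `0` and does not stall near `C`.
  have hg : ∀ t < T, R < D t → D (t + 1) ≤ (1 - q / 2) * D t := fun t ht hr => by
    have := hglobal t ht hr
    have := hall t ht.le
    nlinarith
  have hdec : ∀ t < T, D (t + 1) ≤ D t := by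
    intro t ht
    have h3 := hall t ht.le
    rcases le_or_gt (D t) R with hr | hr
    · have := hlocal t ht hr
      nlinarith
    · have := hg t ht hr
      nlinarith
  have hphase1 : ∀ t ≤ T, D t ≤ R ∨ D t ≤ (1 - q / 2) ^ t * D 0 := by
    intro t
    induction t with
    | zero => intro _; right; simp
    | succ t ih =>
      intro ht
      rcases le_or_gt (D t) R with hr | hr
      · exact Or.inl ((hdec t (by omega)).trans hr)
      · right
        have h3 := (ih (by omega)).resolve_left (not_le.2 hr)
        calc D (t + 1) ≤ (1 - q / 2) * D t := hg t (by omega) hr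
          _ ≤ (1 - q / 2) * ((1 - q / 2) ^ t * D 0) := by
            apply mul_le_mul_of_nonneg_left h3; linarith
          _ = _ := by ring
  have hexp : ∀ (a : ℝ) (n : ℕ), a ≤ 1 → (1 - a) ^ n ≤ Real.exp (-(a * n)) := by
    intro a n ha
    calc (1 - a) ^ n ≤ Real.exp (-a) ^ n :=
          pow_le_pow_left₀ (by linarith) (Real.one_sub_le_exp_neg a) n
      _ = _ := by rw [← Real.exp_nat_mul]; congr 1; ring
  have hT₁R : D T₁ ≤ R := by
    rcases hphase1 T₁ hT₁ with h | h
    · exact h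
    · refine h.trans (le_trans ?_ h1)
      rw [mul_comm]
      exact mul_le_mul_of_nonneg_left (hexp _ _ (by linarith)) hD0
  have hD₁ : D T₁ ≤ D 0 := by
    have : ∀ t ≤ T, D t ≤ D 0 := by
      intro t
      induction t with
      | zero => intro _; exact le_rfl
      | succ t ih => intro ht; exact (hdec t (by omega)).trans (ih (by omega))
    exact this T₁ hT₁
  -- Monotonicity keeps the sequence inside the radius once it has entered, so the local rate
  -- applies at every later step.
  have hphase2 : ∀ s, T₁ + s ≤ T → D (T₁ + s) ≤ R ∧ D (T₁ + s) - C ≤ (1 - p) ^ s * D 0 := by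
    intro s
    induction s with
    | zero => intro _; refine ⟨hT₁R, ?_⟩; simp only [add_zero, pow_zero, one_mul]; linarith
    | succ s ih =>
      intro hs
      obtain ⟨h3, h4⟩ := ih (by omega)
      refine ⟨(hdec (T₁ + s) (by omega)).trans h3, ?_⟩
      calc D (T₁ + s + 1) - C ≤ (1 - p) * (D (T₁ + s) - C) := hlocal _ (by omega) h3
        _ ≤ (1 - p) * ((1 - p) ^ s * D 0) := mul_le_mul_of_nonneg_left h4 (by linarith)
        _ = _ := by ring
  have h5 := (hphase2 (T - T₁) (by omega)).2
  rw [Nat.add_sub_cancel' hT₁] at h5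
  have h6 := mul_le_mul_of_nonneg_left (hexp p (T - T₁) hp1) hD0
  linarith

theorem mul_exp_neg_le_of_log_le {a b s : ℝ} (ha : 0 ≤ a) (hb : 0 < b)
    (h : Real.posLog (a / b) ≤ s) : a * Real.exp (-s) ≤ b := by
  rcases ha.eq_or_lt with rfl | ha
  · simpa using hb.le
  have h1 : Real.log (a / b) ≤ s := (le_max_right _ _).trans h
  have h2 : a / b ≤ Real.exp s := (Real.log_le_iff_le_exp (by positivity)).1 h1
  rw [Real.exp_neg, ← div_eq_mul_inv, div_le_iff₀ (Real.exp_pos s)]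
  rw [div_le_iff₀ hb] at h2
  linarith

theorem cost_gradEstimate {d : ℕ} (f : Eucl d → ℝ) (α : ℝ) (x : Eucl d) (ss : List (Eucl d)) :
    (gradEstimate α x ss).cost f = 2 * ss.length := by
  induction ss with
  | nil => rfl
  | cons s ss ih =>
    simp only [gradEstimate, OracleProgram.cost, OracleProgram.cost_bind, ih, List.length_cons]
    omega

theorem cost_zoAlgorithm {d l : ℕ} (f : Eucl d → ℝ) (α : ℝ) (η : Eucl d → ℝ)
    (S : ℕ → Matrix (Fin d) (Fin l) ℝ) (x₀ : Eucl d) (T : ℕ) :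
    (zoAlgorithm α η S x₀ T).cost f = 2 * l * T := by
  induction T with
  | zero => rfl
  | succ T ih =>
    simp only [zoAlgorithm, OracleProgram.cost, OracleProgram.cost_bind, ih, cost_gradEstimate,
      List.length_ofFn]
    ring

theorem run_zoAlgorithm_succ {d l : ℕ} (f : Eucl d → ℝ) (α : ℝ) (η : Eucl d → ℝ)
    (S : ℕ → Matrix (Fin d) (Fin l) ℝ) (x₀ : Eucl d) (t : ℕ) :
    (zoAlgorithm α η S x₀ (t + 1)).run f =
      zoStep f α (η ((zoAlgorithm α η S x₀ t).run f)) ((zoAlgorithm α η S x₀ t).run f) (S t) := by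
  simp only [zoAlgorithm, OracleProgram.run_bind, OracleProgram.run, run_gradEstimate]
  rfl

end Iteration

/-! ### Union bound along the random iteration -/

section Probability

theorem measure_compl_le_of_le {Ω : Type*} [MeasurableSpace Ω] {P : Measure Ω}
    [IsProbabilityMeasure P] {A : Set Ω} (hA : MeasurableSet A) {δ : ℝ}
    (h : ENNReal.ofReal (1 - δ) ≤ P A) : P Aᶜ ≤ ENNReal.ofReal δ := by
  rw [prob_compl_eq_one_sub hA, tsub_le_iff_right]
  calc (1 : ENNReal) = ENNReal.ofReal (δ + (1 - δ)) := by simp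
    _ ≤ ENNReal.ofReal δ + ENNReal.ofReal (1 - δ) := ENNReal.ofReal_add_le
    _ ≤ _ := by gcongr

theorem le_measure_of_compl_le {Ω : Type*} [MeasurableSpace Ω] {P : Measure Ω}
    [IsProbabilityMeasure P] {A : Set Ω} {δ : ℝ} (hδ : 0 ≤ δ)
    (h : P Aᶜ ≤ ENNReal.ofReal δ) : ENNReal.ofReal (1 - δ) ≤ P A := by
  rw [ENNReal.ofReal_sub _ hδ, ENNReal.ofReal_one, tsub_le_iff_right]
  calc (1 : ENNReal) = P (A ∪ Aᶜ) := by simp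
    _ ≤ P A + P Aᶜ := measure_union_le _ _
    _ ≤ _ := by gcongr

/-- The iterate at time `t` is a function of the sketches with index below `t` only; its
independence from `S t` rests on this. -/
theorem measurable_iterate_iSup {Ω X M : Type*} [MeasurableSpace Ω] [MeasurableSpace X]
    [mM : MeasurableSpace M] {T : ℕ} {S : ℕ → Ω → M} {x : ℕ → Ω → X}
    {step : X → M → X} (hstep : Measurable (Function.uncurry step)) {x₀ : X}
    (h0 : ∀ ω, x 0 ω = x₀) (hx : ∀ t ω, x (t + 1) ω = step (x t ω) (S t ω)) :
    ∀ t ≤ T, Measurable[⨆ i ∈ {i : Fin T | (i : ℕ) < t}, MeasurableSpace.comap (S i) mM] (x t) := by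
  intro t
  induction t with
  | zero =>
    intro _
    rw [show x 0 = fun _ => x₀ from funext h0]
    exact measurable_const
  | succ t ih =>
    intro ht
    set m : MeasurableSpace Ω :=
      ⨆ i ∈ {i : Fin T | (i : ℕ) < t + 1}, MeasurableSpace.comap (S i) mM with hm
    have h1 : Measurable[m] (x t) := (ih (by omega)).mono
      (biSup_mono fun i (hi : (i : ℕ) < t) => (Nat.lt_succ_of_lt hi : (i : ℕ) < t + 1)) le_rfl
    have h2 : Measurable[m] (S t) := by
      rw [measurable_iff_comap_le]
      exact le_biSup (fun i : Fin T => MeasurableSpace.comap (S i) mM)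
        (i := ⟨t, by omega⟩) (show t < t + 1 by omega)
    rw [show x (t + 1) = fun ω => Function.uncurry step (x t ω, S t ω) from funext (hx t)]
    exact hstep.comp (Measurable.prodMk h1 h2)

theorem indepFun_iterate {Ω X M : Type*} [MeasurableSpace Ω] [mX : MeasurableSpace X]
    [mM : MeasurableSpace M] {P : Measure Ω} {T : ℕ} {S : ℕ → Ω → M} {x : ℕ → Ω → X}
    (hS : ∀ t < T, Measurable (S t)) (hind : iIndepFun (fun t : Fin T => S t) P)
    {step : X → M → X} (hstep : Measurable (Function.uncurry step)) {x₀ : X}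
    (h0 : ∀ ω, x 0 ω = x₀) (hx : ∀ t ω, x (t + 1) ω = step (x t ω) (S t ω)) {t : ℕ}
    (ht : t < T) : IndepFun (x t) (S t) P := by
  have h1 := indep_iSup_of_disjoint (m := fun i : Fin T => MeasurableSpace.comap (S i) mM)
    (fun i => measurable_iff_comap_le.1 (hS i i.2)) hind.iIndep
    (S := {i : Fin T | (i : ℕ) < t}) (T := {⟨t, ht⟩}) (by
      rw [Set.disjoint_singleton_right]
      exact lt_irrefl t)
  rw [iSup_singleton] at h1
  exact indep_of_indep_of_le_left h1
    (measurable_iff_comap_le.1 (measurable_iterate_iSup hstep h0 hx t ht.le))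

/-- A union bound along a random iteration driven by independent inputs: if at every fixed point
an input is bad with probability at most `b`, then some step of the iteration is bad with
probability at most `T * b`. -/
theorem measure_exists_bad_le {Ω X M : Type*} [MeasurableSpace Ω] [mX : MeasurableSpace X]
    [mM : MeasurableSpace M] {P : Measure Ω} [IsProbabilityMeasure P] {T : ℕ} {S : ℕ → Ω → M}
    {x : ℕ → Ω → X} (hS : ∀ t < T, Measurable (S t)) (hind : iIndepFun (fun t : Fin T => S t) P)
    {step : X → M → X} (hstep : Measurable (Function.uncurry step)) {x₀ : X}
    (h0 : ∀ ω, x 0 ω = x₀) (hx : ∀ t ω, x (t + 1) ω = step (x t ω) (S t ω))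
    {G : Set (X × M)} (hG : MeasurableSet G) {b : ENNReal}
    (hb : ∀ t < T, ∀ y, P {ω | (y, S t ω) ∉ G} ≤ b) :
    P {ω | ∃ t < T, (x t ω, S t ω) ∉ G} ≤ T * b := by
  have key : ∀ t < T, P {ω | (x t ω, S t ω) ∉ G} ≤ b := by
    intro t ht
    have hxm : Measurable (x t) := (measurable_iterate_iSup (T := T) hstep h0 hx t ht.le).mono
      (iSup₂_le fun i _ => measurable_iff_comap_le.1 (hS i i.2)) le_rfl
    have hi := indepFun_iterate hS hind hstep h0 hx ht
    have hmap := (indepFun_iff_map_prod_eq_prod_map_map hxm.aemeasurable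
      (hS t ht).aemeasurable).1 hi
    have h1 : P {ω | (x t ω, S t ω) ∉ G} = (P.map fun ω => (x t ω, S t ω)) Gᶜ := by
      rw [Measure.map_apply (hxm.prodMk (hS t ht)) hG.compl]; rfl
    have : IsProbabilityMeasure (P.map (x t)) := Measure.isProbabilityMeasure_map hxm.aemeasurable
    have : IsProbabilityMeasure (P.map (S t)) :=
      Measure.isProbabilityMeasure_map (hS t ht).aemeasurable
    -- By independence the joint law is a product, so Fubini freezes the iterate and the bound at
    -- fixed points applies.
    rw [h1, hmap, Measure.prod_apply hG.compl]
    calc ∫⁻ y, (P.map (S t)) (Prod.mk y ⁻¹' Gᶜ) ∂(P.map (x t))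
        ≤ ∫⁻ _, b ∂(P.map (x t)) := by
          refine lintegral_mono fun y => ?_
          rw [Measure.map_apply (hS t ht) (measurable_prodMk_left hG.compl)]
          exact hb t ht y
      _ = b := by simp
  have hset : {ω | ∃ t < T, (x t ω, S t ω) ∉ G} =
      ⋃ t ∈ Finset.range T, {ω | (x t ω, S t ω) ∉ G} := by
    ext ω; simp
  rw [hset]
  calc _ ≤ ∑ t ∈ Finset.range T, P {ω | (x t ω, S t ω) ∉ G} := measure_biUnion_finset_le _ _
    _ ≤ ∑ _t ∈ Finset.range T, b := Finset.sum_le_sum fun t ht => key t (Finset.mem_range.1 ht)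
    _ = T * b := by simp

variable {d l : ℕ}

instance matrixBorelSpace {m n : ℕ} : BorelSpace (Matrix (Fin m) (Fin n) ℝ) :=
  inferInstanceAs (BorelSpace (Fin m → Fin n → ℝ))

instance matrixSecondCountableTopology {m n : ℕ} :
    SecondCountableTopology (Matrix (Fin m) (Fin n) ℝ) :=
  inferInstanceAs (SecondCountableTopology (Fin m → Fin n → ℝ))

theorem continuous_matCol (i : Fin l) :
    Continuous fun S : Matrix (Fin d) (Fin l) ℝ => matCol S i := by
  unfold matCol
  refine (PiLp.continuous_toLp 2 _).comp (continuous_pi fun j => ?_)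
  exact (continuous_apply i).comp (continuous_apply j)

theorem continuous_sketchSq {Y : Type*} [TopologicalSpace Y] {s : Y → Matrix (Fin d) (Fin l) ℝ}
    {v : Y → Eucl d} (hs : Continuous s) (hv : Continuous v) :
    Continuous fun y => sketchSq (s y) (v y) := by
  unfold sketchSq
  exact continuous_finsetSum _ fun i _ => (((continuous_matCol i).comp hs).inner hv).pow 2

theorem continuous_colComb (u : Fin l → ℝ) :
    Continuous fun S : Matrix (Fin d) (Fin l) ℝ => colComb S u :=
  continuous_finsetSum _ fun i _ => (continuous_matCol i).const_smul (u i)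

/-- The pairs of a point and a sketching matrix for which the step succeeds. -/
def goodPairs (φ : Eucl d → ℝ) (l : ℕ) (Q C₁ C₃ : ℝ) : Set (Eucl d × Matrix (Fin d) (Fin l) ℝ) :=
  {p | IsGoodSketch p.2 Q (gradient φ p.1) (hessian φ p.1) C₁ ∧ ∑ i, ‖matCol p.2 i‖ ^ 6 ≤ C₃ ^ 3}

/-- An intersection of closed conditions, possibly uncountable, is closed and hence measurable.
Fubini needs measurability jointly in the point and the sketch. -/
theorem isClosed_goodPairs {φ : Eucl d → ℝ} (h : ContDiff ℝ 2 φ) (Q C₁ C₃ : ℝ) :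
    IsClosed (goodPairs φ l Q C₁ C₃) := by
  have hg : Continuous fun p : Eucl d × Matrix (Fin d) (Fin l) ℝ => gradient φ p.1 :=
    (continuous_gradient h).comp continuous_fst
  have hH : Continuous fun p : Eucl d × Matrix (Fin d) (Fin l) ℝ => hessian φ p.1 :=
    (continuous_hessian h).comp continuous_fst
  have e : goodPairs φ l Q C₁ C₃ = (⋂ v : Eucl d, {p | sketchSq p.2 v ≤ Q * ‖v‖ ^ 2}) ∩
      {p | 485 / 1000 * ‖gradient φ p.1‖ ^ 2 ≤ sketchSq p.2 (gradient φ p.1)} ∩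
      {p | sketchSq p.2 (gradient φ p.1) ≤ 15125 / 10000 * ‖gradient φ p.1‖ ^ 2} ∩
      (⋂ u : Fin l → ℝ, {p | inner ℝ (hessian φ p.1 (colComb p.2 u)) (colComb p.2 u) ≤
        C₁ * ∑ i, u i ^ 2}) ∩ {p | ∑ i, ‖matCol p.2 i‖ ^ 6 ≤ C₃ ^ 3} := by
    ext p
    simp only [goodPairs, Set.mem_inter_iff, Set.mem_iInter, Set.mem_ofPred_eq]
    exact ⟨fun ⟨⟨a, b, c, d⟩, e⟩ => ⟨⟨⟨⟨a, b⟩, c⟩, d⟩, e⟩,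
      fun ⟨⟨⟨⟨a, b⟩, c⟩, d⟩, e⟩ => ⟨⟨a, b, c, d⟩, e⟩⟩
  rw [e]
  have hc : ∀ u : Fin l → ℝ,
      Continuous fun p : Eucl d × Matrix (Fin d) (Fin l) ℝ => colComb p.2 u := fun u =>
    (continuous_colComb u).comp continuous_snd
  refine ((((isClosed_iInter fun v => ?_).inter ?_).inter ?_).inter
    (isClosed_iInter fun u => ?_)).inter ?_
  · exact isClosed_le (continuous_sketchSq continuous_snd continuous_const) continuous_const
  · exact isClosed_le (continuous_const.mul (hg.norm.pow 2)) (continuous_sketchSq continuous_snd hg)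
  · exact isClosed_le (continuous_sketchSq continuous_snd hg) (continuous_const.mul (hg.norm.pow 2))
  · exact isClosed_le ((hH.clm_apply (hc u)).inner (hc u)) continuous_const
  · exact isClosed_le (continuous_finsetSum _ fun i _ =>
      ((continuous_matCol i).comp continuous_snd).norm.pow 6) continuous_const

theorem measurable_zoStep {f : Eucl d → ℝ} (hf : Measurable f) (α : ℝ) {η : Eucl d → ℝ}
    (hη : Measurable η) : Measurable (Function.uncurry fun (x : Eucl d)
      (S : Matrix (Fin d) (Fin l) ℝ) => zoStep f α (η x) x S) := by
  have hc : ∀ i : Fin l, Measurable fun p : Eucl d × Matrix (Fin d) (Fin l) ℝ => matCol p.2 i :=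
    fun i => ((continuous_matCol i).comp continuous_snd).measurable
  have hu : ∀ i : Fin l, Measurable fun p : Eucl d × Matrix (Fin d) (Fin l) ℝ =>
      (f (p.1 + α • matCol p.2 i) - f (p.1 - α • matCol p.2 i)) / (2 * α) := fun i =>
    ((hf.comp (measurable_fst.add ((hc i).const_smul α))).sub
      (hf.comp (measurable_fst.sub ((hc i).const_smul α)))).div_const _
  exact measurable_fst.sub ((hη.comp measurable_fst).smul
    (Finset.measurable_fun_sum _ fun i _ => (hu i).smul (hc i)))

theorem measurable_stepSize {φ : Eucl d → ℝ} (h : Continuous φ) (φmin k L Lh : ℝ) :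
    Measurable (stepSize φ φmin k L Lh) := by
  unfold stepSize
  refine Measurable.ite ?_ measurable_const measurable_const
  exact (isClosed_le (Real.continuous_sqrt.comp (h.sub continuous_const))
    continuous_const).measurableSet

end Probability

/-! ### Iteration and query complexity -/

section Complexity

theorem constC2_sq (d : ℕ) {k : ℝ} (hk : 0 < k) : constC2 d k ^ 2 = 5 / 4 + d / (4 * k) :=
  Real.sq_sqrt (by positivity)

theorem constC2_pos (d : ℕ) {k : ℝ} (hk : 0 < k) : 0 < constC2 d k :=
  Real.sqrt_pos.2 (by positivity)

/-- The bound on `‖S‖²` provided by the sketching event. -/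
noncomputable def sketchNormBound (d l : ℕ) (k : ℝ) : ℝ :=
  if l < 8 then 5 / 4 + d / (4 * k) else 4 * (5 / 4 + d / (4 * k))

theorem sketchNormBound_nonneg (d l : ℕ) {k : ℝ} (hk : 0 < k) : 0 ≤ sketchNormBound d l k := by
  unfold sketchNormBound
  split_ifs <;> positivity

theorem sketchNormBound_le (d l : ℕ) {k : ℝ} (hk : 0 < k) :
    sketchNormBound d l k ≤ 4 * constC2 d k ^ 2 := by
  rw [constC2_sq d hk, sketchNormBound]
  have : 0 ≤ 5 / 4 + (d : ℝ) / (4 * k) := by positivity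
  split_ifs <;> linarith

/-- The factor `4³ = 64` lost by the combined event is paid by `ℓ ≤ ℓ³ / 64`, which holds exactly
from `ℓ = 8` on. This is the origin of the threshold. -/
theorem mul_sketchNormBound_pow_le (d l : ℕ) (hl : 0 < l) {k : ℝ} (hk : 0 < k) :
    l * sketchNormBound d l k ^ 3 ≤ (5 * l / 4 + d * l / (4 * k)) ^ 3 := by
  set B := 5 / 4 + (d : ℝ) / (4 * k) with hB
  have hB0 : 0 ≤ B := by positivity
  have e : (5 * l / 4 + d * l / (4 * k) : ℝ) = l * B := by rw [hB]; ring
  have hl1 : (1 : ℝ) ≤ l := by exact_mod_cast hl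
  rw [e, sketchNormBound, ← hB, mul_pow]
  split_ifs with h
  · gcongr
    exact le_self_pow₀ hl1 (by norm_num)
  · have hl8 : (8 : ℝ) ≤ l := by exact_mod_cast not_lt.1 h
    have h1 : (l : ℝ) * 64 ≤ l ^ 3 := by
      calc (l : ℝ) * 64 = l * 8 ^ 2 := by ring
        _ ≤ l * l ^ 2 := by gcongr
        _ = l ^ 3 := by ring
    calc (l : ℝ) * (4 * B) ^ 3 = (l * 64) * B ^ 3 := by ring
      _ ≤ _ := by gcongr

theorem prob_not_mem_goodPairs_le {d l : ℕ} (hd : 0 < d) (hl : 0 < l) {φ : Eucl d → ℝ}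
    (h : ContDiff ℝ 2 φ) {μ L k δ C₃ : ℝ} (hμ : 0 < μ) (hL0 : 0 < L) (hk : 40 ≤ k) (hδ : δ < 1)
    (hc : IsStronglyConvex φ μ) (hL : IsSmoothWith φ L) {Ω : Type*} [MeasurableSpace Ω]
    {P : Measure Ω} [IsProbabilityMeasure P] {S : Ω → Matrix (Fin d) (Fin l) ℝ}
    (hSm : Measurable S) (hS : IsObliviousSketch P (1 / 4) k δ S)
    (hC₃ : C₃ = 5 * l / 4 + d * l / (4 * k) ∨ (C₃ = d ∧ ∀ᵐ ω ∂P, frobeniusSq (S ω) = d))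
    (y : Eucl d) :
    P {ω | (y, S ω) ∉ goodPairs φ l (sketchNormBound d l k) (constC1 φ k) C₃} ≤
      ENNReal.ofReal δ := by
  have hk0 : 0 < k := by linarith
  have hCH := le_constC1 h hμ hL0 hk0 hc hL y
  obtain ⟨A, hA⟩ : ∃ A : Matrix (Fin d) (Fin d) ℝ, ∀ S : Matrix (Fin d) (Fin l) ℝ,
      spectralNorm₂ (Aᵀ * S * Sᵀ * A - Aᵀ * A) ≤
        1 / 4 * (spectralNorm₂ A ^ 2 + frobeniusSq A / k) →
      IsGoodSketch S (sketchNormBound d l k) (gradient φ y) (hessian φ y) (constC1 φ k) := by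
    by_cases hl8 : l < 8
    · have hd8 : d < 8 := by
        by_contra! hd8
        -- The event has positive probability because `δ < 1`, so some outcome realizes it and
        -- contradicts `ℓ < 8`.
        obtain ⟨A, hA⟩ := exists_matrix_eight_le (l := l) hd8 hk
        have hpos : 0 < P {ω | spectralNorm₂ (Aᵀ * S ω * (S ω)ᵀ * A - Aᵀ * A) ≤
            1 / 4 * (spectralNorm₂ A ^ 2 + frobeniusSq A / k)} :=
          (ENNReal.ofReal_pos.2 (by linarith)).trans_le (hS A)
        obtain ⟨ω, hω⟩ := nonempty_of_measure_ne_zero hpos.ne'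
        exact absurd (hA (S ω) hω) (not_le.2 hl8)
      rw [sketchNormBound, if_pos hl8]
      exact exists_matrix_isGoodSketch_of_small hd hd8 hk hμ (inner_hessian_symm h y)
        (mul_norm_sq_le_inner_hessian h hc y) hCH
    · rw [sketchNormBound, if_neg hl8]
      exact exists_matrix_isGoodSketch hd hk hμ (inner_hessian_symm h y)
        (mul_norm_sq_le_inner_hessian h hc y) hCH
  have hmeas : MeasurableSet
      {ω | (y, S ω) ∈ goodPairs φ l (sketchNormBound d l k) (constC1 φ k) C₃} :=
    (measurable_const.prodMk hSm) (isClosed_goodPairs h _ _ _).measurableSet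
  refine measure_compl_le_of_le hmeas ((hS A).trans ?_)
  rcases hC₃ with rfl | ⟨rfl, hfro⟩
  · refine measure_mono fun ω hω => ?_
    have hg := hA (S ω) hω
    exact ⟨hg, sum_norm_matCol_pow_six_le (sketchNormBound_nonneg d l hk0) hg.upper
      (mul_sketchNormBound_pow_le d l hl hk0)⟩
  · refine measure_mono_ae ?_
    filter_upwards [hfro] with ω hω hωA
    exact ⟨hA (S ω) hωA, sum_norm_matCol_pow_six_le_of_frobeniusSq hω⟩

/-- Along any sequence of good sketches the algorithm reaches the accuracy `ε + C₄`. -/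
theorem run_zoAlgorithm_sub_le {d l T : ℕ} (hd : 0 < d) {φ f : Eucl d → ℝ}
    (h : ContDiff ℝ 2 φ) {μ L Lh α σ k ε C₃ : ℝ} (hμ : 0 < μ) (hL0 : 0 < L) (hLh : 0 < Lh)
    (hα : 0 < α) (hσ : 0 ≤ σ) (hk : 0 < k) (hε : 0 < ε) (hC₃ : 0 ≤ C₃)
    (hc : IsStronglyConvex φ μ) (hL : IsSmoothWith φ L) (hH : HasLipschitzHessian φ Lh)
    (hf : ∀ x, |f x - φ x| ≤ σ) {xstar x₀ : Eucl d} (hmin : IsMinOn φ Set.univ xstar)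
    {S : ℕ → Matrix (Fin d) (Fin l) ℝ}
    (hgood : ∀ t < T, ((zoAlgorithm α (stepSize φ (φ xstar) k L Lh) S x₀ t).run f, S t) ∈
      goodPairs φ l (sketchNormBound d l k) (constC1 φ k) C₃)
    (hT : 5 * (5 + d / k) * L / μ * Real.posLog ((φ x₀ - φ xstar) /
        localRadius (constC1 φ k) (constC2 d k) L Lh ^ 2) + 1 +
      4 * constC1 φ k / μ * Real.posLog ((φ x₀ - φ xstar) / ε) ≤ T) :
    φ ((zoAlgorithm α (stepSize φ (φ xstar) k L Lh) S x₀ T).run f) - φ xstar ≤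
      ε + constC4 l (constC1 φ k) (constC2 d k) C₃ μ Lh σ α := by
  set C₁ := constC1 φ k with hC₁
  set C₂ := constC2 d k with hC₂
  have hC₁μ : 5 * μ ≤ C₁ := five_mul_le_constC1 h hd hμ hL0 hk hc hL
  have hC₁0 : 0 < C₁ := by linarith
  have hC₂0 : 0 < C₂ := constC2_pos d hk
  have hC₂sq : 4 * C₂ ^ 2 = 5 + d / k := by
    rw [hC₂, constC2_sq d hk]; field_simp
  set r := localRadius C₁ C₂ L Lh with hr
  have hr0 : 0 < r := by rw [hr, localRadius]; positivity
  set x : ℕ → Eucl d := fun t => (zoAlgorithm α (stepSize φ (φ xstar) k L Lh) S x₀ t).run f with hx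
  have hxs : ∀ t, x (t + 1) = zoStep f α (stepSize φ (φ xstar) k L Lh (x t)) (x t) (S t) :=
    fun t => run_zoAlgorithm_succ f α _ S x₀ t
  set C := constC4 l C₁ C₂ C₃ μ Lh σ α with hC
  have hC0 : 0 ≤ C := by
    have h1 := mul_constC4 l (C₁ := C₁) (C₂ := C₂) (Lh := Lh) (σ := σ) (α := α) hμ hC₃
    have h2 : 0 ≤ μ * C := by rw [hC, h1]; positivity
    exact nonneg_of_mul_nonneg_right h2 hμ
  have hD0 : ∀ y, 0 ≤ φ y - φ xstar := fun y => sub_nonneg.2 (hmin (Set.mem_univ y))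
  set η := (5 + (d : ℝ) / k)⁻¹ * L⁻¹ with hη
  have hdk : 0 ≤ (d : ℝ) / k := by positivity
  have hη0 : 0 < η := by positivity
  have hηL : η * L * (4 * C₂ ^ 2) = 1 := by rw [hC₂sq, hη]; field_simp
  have hμL := strongConvexity_le_smoothness h hd hμ hL0 hc hL
  have hημ : η * μ ≤ 1 := by
    have h1 : η * μ ≤ η * L := by gcongr
    have h2 : η * L * 1 ≤ η * L * (4 * C₂ ^ 2) := by gcongr; linarith
    linarith
  set a := 5 * (5 + (d : ℝ) / k) * L / μ * Real.posLog ((φ x₀ - φ xstar) / r ^ 2) with ha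
  have ha0 : 0 ≤ a := mul_nonneg (by positivity) Real.posLog_nonneg
  set b := 4 * C₁ / μ * Real.posLog ((φ x₀ - φ xstar) / ε) with hb
  have hb0 : 0 ≤ b := mul_nonneg (by positivity) Real.posLog_nonneg
  -- The first phase gets `⌈a⌉` steps; the summand `1` in the hypothesis on `T` pays for the
  -- rounding.
  have hT₁ : (⌈a⌉₊ : ℝ) < a + 1 := Nat.ceil_lt_add_one ha0
  have hT₁T : ⌈a⌉₊ ≤ T := by
    have : (⌈a⌉₊ : ℝ) ≤ T := by linarith
    exact_mod_cast this
  have key := le_add_of_two_phase (D := fun t => φ (x t) - φ xstar) (C := C) (R := r ^ 2)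
    (p := μ / (4 * C₁)) (q := 2 / 5 * (η * μ)) (ε := ε) (T := T) (T₁ := ⌈a⌉₊) hC0 (by positivity)
    (by positivity) (by rw [div_le_one (by positivity)]; linarith) (by positivity) (by linarith)
    hε (hD0 _)
    (fun t ht hle => by
      have hsq : √(φ (x t) - φ xstar) ≤ r := Real.sqrt_le_iff.2 ⟨hr0.le, hle⟩
      obtain ⟨hg, h6⟩ := hgood t ht
      have := local_step h hμ hL0 hLh hα hσ hC₁0 hC₂0 hC₃ (sketchNormBound_nonneg d l hk)
        (sketchNormBound_le d l hk) hc hL hH hf hmin hg h6 hsq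
      rw [hxs, stepSize, if_pos hsq]
      exact this)
    (fun t ht hlt => by
      have hsq : ¬ √(φ (x t) - φ xstar) ≤ r := fun hle =>
        absurd ((Real.sqrt_le_iff.1 hle).2) (not_le.2 hlt)
      obtain ⟨hg, h6⟩ := hgood t ht
      have := global_step (C₁ := C₁) h hμ hL0 hLh hα hσ hC₂0 hC₃ (sketchNormBound_nonneg d l hk)
        (sketchNormBound_le d l hk) hc hL hH hf hmin hg h6 hη0 hηL.le
      rw [hxs, stepSize, if_neg hsq]
      exact this)
    hT₁T
    (mul_exp_neg_le_of_log_le (hD0 _) (by positivity) (by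
      have h1 : 2 / 5 * (η * μ) / 2 * a = Real.posLog ((φ x₀ - φ xstar) / r ^ 2) := by
        rw [ha, hη]; field_simp
      change Real.posLog ((φ x₀ - φ xstar) / r ^ 2) ≤ _
      rw [← h1]
      gcongr
      exact Nat.le_ceil a))
    (mul_exp_neg_le_of_log_le (hD0 _) hε (by
      have h1 : μ / (4 * C₁) * b = Real.posLog ((φ x₀ - φ xstar) / ε) := by
        rw [hb]; field_simp
      change Real.posLog ((φ x₀ - φ xstar) / ε) ≤ _
      rw [← h1, Nat.cast_sub hT₁T]
      gcongr
      linarith))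
  linarith

theorem half_le_log_one_div {ε : ℝ} (hε : 0 < ε) (hε' : ε ≤ 1 / 2) :
    1 / 2 ≤ Real.log (1 / ε) := by
  have h1 : (2 : ℝ) ≤ 1 / ε := by rw [le_div_iff₀ hε]; linarith
  have h2 := Real.log_le_log (by norm_num) h1
  linarith [Real.log_two_gt_d9]

/-- Subadditivity splits off `log (1 / ε)`; since `ε ≤ 1 / 2` keeps it at least `1 / 2`, the sum is
absorbed in a product with constant 2. -/
theorem posLog_div_le {D ε : ℝ} (hε : 0 < ε) (hε' : ε ≤ 1 / 2) :
    Real.posLog (D / ε) ≤ 2 * ((1 + Real.posLog D) * Real.log (1 / ε)) := by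
  have h1 := half_le_log_one_div hε hε'
  have h2 : Real.posLog (1 / ε) = Real.log (1 / ε) := max_eq_right (by linarith)
  have h3 : Real.posLog (D / ε) ≤ Real.posLog D + Real.log (1 / ε) := by
    rw [← h2, div_eq_mul_one_div]
    exact Real.posLog_mul
  have h4 : 0 ≤ Real.posLog D := Real.posLog_nonneg
  nlinarith

/-- From `ℓ ≤ 2 c k` the term `ℓ tr / k` is at most `2 c tr`, pointwise before taking suprema. -/
theorem mul_constC1_le {d l : ℕ} (hl : 0 < l) {φ : Eucl d → ℝ} (h : ContDiff ℝ 2 φ)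
    {μ L k c : ℝ} (hμ : 0 < μ) (hL0 : 0 < L) (hk : 0 < k) (hc : 0 < c)
    (hsc : IsStronglyConvex φ μ) (hL : IsSmoothWith φ L) (hlk : (l : ℝ) ≤ 2 * c * k) :
    l * constC1 φ k ≤ (5 + 2 * c) * ⨆ x, (‖hessian φ x‖ * l + hessianTrace φ x) := by
  have hl0 : (0 : ℝ) < l := by exact_mod_cast hl
  set W := ⨆ x, (‖hessian φ x‖ * l + hessianTrace φ x) with hW
  have hWle : ∀ x, ‖hessian φ x‖ * l + hessianTrace φ x ≤ W := by
    have hb := bddAbove_norm_hessian_add_trace h hμ hL0 hsc hL (a := l) (b := 1) hl0.le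
      zero_le_one
    refine fun x => le_ciSup (f := fun x => ‖hessian φ x‖ * l + hessianTrace φ x) ?_ x
    simpa only [one_mul, mul_comm (l : ℝ)] using hb
  rw [← le_div_iff₀' hl0, constC1]
  refine ciSup_le fun x => ?_
  rw [le_div_iff₀' hl0]
  have h2 := hessianTrace_nonneg h hμ hsc x
  have h3 : l * (hessianTrace φ x / k) ≤ 2 * c * hessianTrace φ x := by
    rw [← mul_div_assoc, div_le_iff₀ hk]
    calc (l : ℝ) * hessianTrace φ x ≤ 2 * c * k * hessianTrace φ x := by gcongr
      _ = _ := by ring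
  have h4 : 0 ≤ c * (‖hessian φ x‖ * l) := by positivity
  have h5 : (5 + 2 * c) * (‖hessian φ x‖ * l + hessianTrace φ x) ≤ (5 + 2 * c) * W := by
    gcongr
    exact hWle x
  linarith

/-- The lengths of the two phases are bounded by the iteration number of the theorem. -/
theorem phase_lengths_le {d l : ℕ} (hl : 0 < l) {φ : Eucl d → ℝ} {xstar x₀ : Eucl d}
    {k c μ L Lh ε : ℝ} (hk : 0 < k) (hc : 0 < c) (hμ : 0 < μ) (hL0 : 0 < L)
    (hε : 0 < ε) (hε' : ε ≤ 1 / 2) (hC₁ : 0 < constC1 φ k) (hlk : (l : ℝ) ≤ 2 * c * k)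
    (hld : (l : ℝ) ≤ c * d) :
    5 * (5 + d / k) * L / μ * Real.posLog ((φ x₀ - φ xstar) /
        localRadius (constC1 φ k) (constC2 d k) L Lh ^ 2) +
      4 * constC1 φ k / μ * Real.posLog ((φ x₀ - φ xstar) / ε) ≤
    35 * c * (entryFactor φ (φ xstar) k L Lh x₀ * ((d / l) * (L / μ))) +
      8 * (startFactor φ (φ xstar) x₀ * (constC1 φ k / μ * Real.log (1 / ε))) := by
  have hl0 : (0 : ℝ) < l := by exact_mod_cast hl
  refine add_le_add ?_ ?_
  -- Both column bounds enter: `ℓ ≤ c d` turns the 5 into `5 c d / ℓ`, and `ℓ ≤ 2 c k` turns `d / k`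
  -- into `2 c d / ℓ`.
  · have h1 : 5 + (d : ℝ) / k ≤ 7 * c * (d / l) := by
      have h2 : 1 ≤ c * (d / l) := by rw [← mul_div_assoc, le_div_iff₀ hl0]; linarith
      have h3 : (d : ℝ) / k ≤ 2 * (c * (d / l)) := by
        rw [← mul_div_assoc, ← mul_div_assoc, div_le_div_iff₀ hk hl0]
        calc (d : ℝ) * l ≤ d * (2 * c * k) := by gcongr
          _ = _ := by ring
      linarith
    have h5 : Real.posLog ((φ x₀ - φ xstar) /
        localRadius (constC1 φ k) (constC2 d k) L Lh ^ 2) ≤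
        entryFactor φ (φ xstar) k L Lh x₀ := by
      rw [entryFactor]; linarith
    calc _ ≤ 5 * (7 * c * (d / l)) * L / μ * entryFactor φ (φ xstar) k L Lh x₀ := by
          gcongr
          exact Real.posLog_nonneg
      _ = _ := by ring
  · calc _ ≤ 4 * constC1 φ k / μ *
          (2 * ((1 + Real.posLog (φ x₀ - φ xstar)) * Real.log (1 / ε))) := by
          gcongr; exact posLog_div_le hε hε'
      _ = _ := by rw [startFactor]; ring

/-- The constants `K` (iterations) and `K'` (queries) depend only on the constant `c` of `ℓ = O(k + log (T/δ))` and
`ℓ = O(d)`. -/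
theorem corollary3 (c : ℝ) (hc : 0 < c) :
    ∃ K K' : ℝ, 0 < K ∧ 0 < K' ∧
      ∀ (d l T : ℕ) (k δ μ L Lh σ α ε C₃ : ℝ)
        (φ f : Eucl d → ℝ) (xstar x₀ : Eucl d)
        (Ω : Type*) [MeasurableSpace Ω] (P : Measure Ω) [IsProbabilityMeasure P]
        (S : ℕ → Ω → Matrix (Fin d) (Fin l) ℝ),
        0 < d → 0 < l → 0 < μ → 0 < L → 0 < Lh → 0 ≤ σ → 0 < α →
        0 < δ → δ < 1 → 0 < ε → ε ≤ 1 / 2 →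
        -- the objective function, its minimizer and the noisy oracle
        ContDiff ℝ 2 φ →
        IsStronglyConvex φ μ →
        IsSmoothWith φ L →
        HasLipschitzHessian φ Lh →
        IsMinOn φ Set.univ xstar →
        Measurable f →
        (∀ x, |f x - φ x| ≤ σ) →
        -- the independently generated sketching matrices
        1 ≤ k →
        Real.log (T / δ) < k →
        (l : ℝ) ≤ c * (k + Real.log (T / δ)) →
        (l : ℝ) ≤ c * d →
        (∀ t < T, Measurable (S t)) →
        iIndepFun (fun t : Fin T => S t) P →
        (∀ t < T, IsObliviousSketch P (1 / 4) k (δ / T) (S t)) →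
        -- the constant `C₃`, with the smaller alternative for normalized sketches
        (C₃ = 5 * l / 4 + d * l / (4 * k) ∨
          (C₃ = d ∧ ∀ t < T, ∀ᵐ ω ∂P, frobeniusSq (S t ω) = d)) →
        -- the iteration number and the query complexity
        let N : ℝ :=
          K * (entryFactor φ (φ xstar) k L Lh x₀ * ((d / l) * (L / μ)) +
            startFactor φ (φ xstar) x₀ * (constC1 φ k / μ * Real.log (1 / ε)))
        let alg : Ω → OracleProgram (Eucl d) (Eucl d) := fun ω =>
          zoAlgorithm α (stepSize φ (φ xstar) k L Lh) (fun t => S t ω) x₀ T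
        (N ≤ T →
          ENNReal.ofReal (1 - δ) ≤
            P {ω | φ ((alg ω).run f) - φ xstar ≤
              ε + constC4 l (constC1 φ k) (constC2 d k) C₃ μ Lh σ α}) ∧
        (T = ⌈N⌉₊ →
          ∀ ω, ((alg ω).cost f : ℝ) ≤
            K' * (entryFactor φ (φ xstar) k L Lh x₀ * (d * L / μ) +
              startFactor φ (φ xstar) x₀ *
                (μ⁻¹ * (⨆ x, (‖hessian φ x‖ * l + hessianTrace φ x)) *
                  Real.log (1 / ε)))) := by
  -- The exponential forces `k ≥ 40`, `35 c` covers the first phase, and `9 = 8 + 1` covers the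
  -- second phase and the rounding.
  set K := Real.exp 40 + 35 * c + 9 with hK
  have hexp := Real.exp_pos 40
  have hK0 : 0 < K := by positivity
  refine ⟨K, 4 * K * (5 + 2 * c), hK0, by positivity, ?_⟩
  intro d l T k δ μ L Lh σ α ε C₃ φ f xstar x₀ Ω _ P _ S hd hl hμ hL0 hLh hσ hα hδ hδ1 hε hε'
    h hsc hL hH hmin hfm hf hk1 hkT hlk hld hSm hind hS hC₃ N alg
  have hk0 : 0 < k := by linarith
  have hd0 : (0 : ℝ) < d := by exact_mod_cast hd
  have hl0 : (0 : ℝ) < l := by exact_mod_cast hl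
  have hC₁μ : 5 * μ ≤ constC1 φ k := five_mul_le_constC1 h hd hμ hL0 hk0 hsc hL
  set C₁ := constC1 φ k with hC₁
  have hC₁0 : 0 < C₁ := by linarith
  have hlog := half_le_log_one_div hε hε'
  set lε := Real.log (1 / ε) with hlε
  set Λ₁ := entryFactor φ (φ xstar) k L Lh x₀ with hΛ₁
  set Λ₂ := startFactor φ (φ xstar) x₀ with hΛ₂
  have hΛ₁1 : 1 ≤ Λ₁ := le_add_of_nonneg_right Real.posLog_nonneg
  have hΛ₂1 : 1 ≤ Λ₂ := le_add_of_nonneg_right Real.posLog_nonneg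
  -- The hypothesis `log (T / δ) < k` replaces the logarithm by `k`.
  have hl2 : (l : ℝ) ≤ 2 * c * k := by nlinarith
  -- This gives `N ≥ K`, since `C₁ ≥ 5 μ` and the logarithm is at least `1 / 2`.
  have hX : 1 ≤ Λ₂ * (C₁ / μ * lε) := by
    have h1 : 5 ≤ C₁ / μ := by rw [le_div_iff₀ hμ]; exact hC₁μ
    have h2 : 1 ≤ C₁ / μ * lε := by nlinarith
    nlinarith
  have hY : 0 ≤ Λ₁ * ((d / l) * (L / μ)) := by positivity
  have hNK : K ≤ N := by
    have : K * 1 ≤ K * (Λ₁ * ((d / l) * (L / μ)) + Λ₂ * (C₁ / μ * lε)) := by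
      gcongr; linarith
    simpa using this
  constructor
  · intro hNT
    have hT40 : Real.exp 40 ≤ T := by linarith
    have hT0 : (0 : ℝ) < T := by linarith
    have hT0' : T ≠ 0 := by rintro rfl; simp at hT0
    have hk40 : 40 ≤ k := by
      have h1 : Real.exp 40 ≤ T / δ := by
        rw [le_div_iff₀ hδ]; nlinarith
      have h2 : 40 ≤ Real.log (T / δ) := (Real.le_log_iff_exp_le (by positivity)).2 h1
      linarith
    have hδT : δ / T < 1 := by
      rw [div_lt_one hT0]
      have : (1 : ℝ) ≤ T := by exact_mod_cast Nat.one_le_iff_ne_zero.2 hT0'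
      linarith
    have hC₃0 : 0 ≤ C₃ := by
      rcases hC₃ with rfl | ⟨rfl, -⟩ <;> positivity
    have hcount : 5 * (5 + d / k) * L / μ * Real.posLog ((φ x₀ - φ xstar) /
        localRadius C₁ (constC2 d k) L Lh ^ 2) + 1 +
        4 * C₁ / μ * Real.posLog ((φ x₀ - φ xstar) / ε) ≤ T := by
      refine le_trans ?_ hNT
      have h1 := phase_lengths_le (xstar := xstar) (x₀ := x₀) (Lh := Lh) hl hk0 hc hμ hL0 hε hε' hC₁0 hl2 hld
      have h7 : N = K * (Λ₁ * ((d / l) * (L / μ))) + K * (Λ₂ * (C₁ / μ * lε)) := by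
        rw [← mul_add]
      have h8 : 35 * c * (Λ₁ * ((d / l) * (L / μ))) ≤ K * (Λ₁ * ((d / l) * (L / μ))) := by
        gcongr; linarith
      have h9 : 9 * (Λ₂ * (C₁ / μ * lε)) ≤ K * (Λ₂ * (C₁ / μ * lε)) := by
        gcongr; linarith
      rw [h7]
      linarith
    set η := stepSize φ (φ xstar) k L Lh with hη
    set x : ℕ → Ω → Eucl d := fun t ω => (zoAlgorithm α η (fun t => S t ω) x₀ t).run f with hx
    set G := goodPairs φ l (sketchNormBound d l k) C₁ C₃ with hG
    have hbad : P {ω | ∃ t < T, (x t ω, S t ω) ∉ G} ≤ T * ENNReal.ofReal (δ / T) :=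
      measure_exists_bad_le hSm hind (measurable_zoStep hfm α
        (measurable_stepSize h.continuous (φ xstar) k L Lh)) (x₀ := x₀) (fun ω => rfl)
        (fun t ω => run_zoAlgorithm_succ f α η (fun t => S t ω) x₀ t)
        (isClosed_goodPairs h _ _ _).measurableSet
        (fun t ht y => prob_not_mem_goodPairs_le hd hl h hμ hL0 hk40 hδT hsc hL (hSm t ht)
          (hS t ht) (hC₃.imp id fun h => ⟨h.1, h.2 t ht⟩) y)
    have hTδ : (T : ENNReal) * ENNReal.ofReal (δ / T) = ENNReal.ofReal δ := by
      rw [← ENNReal.ofReal_natCast, ← ENNReal.ofReal_mul hT0.le, mul_div_cancel₀ _ hT0.ne']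
    rw [hTδ] at hbad
    have hgood : ENNReal.ofReal (1 - δ) ≤ P {ω | ∀ t < T, (x t ω, S t ω) ∈ G} := by
      refine le_measure_of_compl_le hδ.le (le_trans (le_of_eq ?_) hbad)
      congr 1
      ext ω
      simp
    refine hgood.trans (measure_mono fun ω hω => ?_)
    exact run_zoAlgorithm_sub_le hd h hμ hL0 hLh hα hσ hk0 hε hC₃0 hsc hL hH hf hmin hω hcount
  · intro hTN ω
    have hN0 : 0 < N := hK0.trans_le hNK
    -- Rounding up at most doubles `N`, because `N ≥ K ≥ 1`.
    have hT2 : (T : ℝ) ≤ 2 * N := by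
      have h1 : (⌈N⌉₊ : ℝ) < N + 1 := Nat.ceil_lt_add_one hN0.le
      rw [hTN]
      linarith
    set W := ⨆ x, (‖hessian φ x‖ * l + hessianTrace φ x) with hW
    have hCW : l * C₁ ≤ (5 + 2 * c) * W := mul_constC1_le hl h hμ hL0 hk0 hc hsc hL hl2
    have hcost : ((alg ω).cost f : ℝ) = 2 * l * T := by
      rw [cost_zoAlgorithm]; push_cast; ring
    rw [hcost]
    calc 2 * (l : ℝ) * T ≤ 2 * l * (2 * N) := by gcongr
      _ = 4 * K * (Λ₁ * (d * L / μ) + Λ₂ * (μ⁻¹ * (l * C₁) * lε)) := by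
        simp only [N]; field_simp; ring
      _ ≤ 4 * K * ((5 + 2 * c) * (Λ₁ * (d * L / μ)) +
          Λ₂ * (μ⁻¹ * ((5 + 2 * c) * W) * lε)) := by
        refine mul_le_mul_of_nonneg_left (add_le_add ?_ ?_) (by positivity)
        · exact le_mul_of_one_le_left (by positivity) (by linarith)
        · gcongr
      _ = _ := by ring

end Complexity
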